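/- Notation. For a random variable $V$ let $\|V\|_{\psi_2}=\sup_{q\ge 1}q^{-1/2}(\mathbb{E}|V|^q)^{1/q}$, and for a random vector $V\in\mathbb{R}^p$ let $\|V\|_{\psi_2}=\sup_{\|u\|_2=1}\|\langle V,u\rangle\|_{\psi_2}$. Let $\|\theta\|_0$ be the number of nonzero coordinates of $\theta$, and let $\Phi$ be the CDF of $N(0,1)$. Given $y\in\mathbb{R}^n$, $\mathbf{X}\in\mathbb{R}^{n\times p}$, $\lambda$ and $\mu$, let $\hat\theta^n=\hat\theta^n(y,\mathbf{X};\lambda)$ be a (measurably chosen) minimizer over $\theta\in\mathbb{R}^p$ of the LASSO objective $\frac{1}{2n}\|y-\mathbf{X}\theta\|_2^2+\lambda\|\theta\|_1$. Put $\hat\Sigma=\mathbf{X}^\top\mathbf{X}/n$. Let $M=M(\mathbf{X})=(m_1,\dots,m_p)^\top$, where $m_i$ is a (measurably chosen) solution of: minimize $m^\top\hat\Sigma m$ subject to $\|\hat\Sigma m-e_i\|_\infty\le\mu$; if one of these $p$ programs is infeasible, put $M=I_{p\times p}$ instead. The debiased LASSO estimator is $\hat\theta^u=\hat\theta^n+\frac1n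 M\mathbf{X}^\top(y-\mathbf{X}\hat\theta^n)$. Lemma 13 (Asymptotic Normality and Valid Inference for the Debiased LASSO). There is an absolute constant $c_0$ and, for all constants $C_{\min},C_{\max},\kappa\in(0,\infty)$, there is a constant $a_0$ depending only on $C_{\min},C_{\max},\kappa$, such that the following holds for all constants $a\ge a_0$ and $c\ge c_0$. Consider dimensions $n\to\infty$, $p=p(n)\to\infty$ (with $p\ge1$), and integers $s_0=s_0(n)\ge1$ with $s_0=o(\sqrt n/\log p)$. For each $n$ let $\mathbf{X}\in\mathbb{R}^{n\times p}$ be a random design matrix whose rows have covariance matrix $\Sigma\in\mathbb{R}^{p\times p}$ with $\sigma_{\min}(\Sigma)\ge C_{\min}$, $\sigma_{\max}(\Sigma)\le C_{\max}$ and $\max_{i}\Sigma_{ii}\le1$, such that the rows of $\mathbf{X}\Sigma^{-1/2}$ are independent, with zero mean and sub-Gaussian norm at most $\kappa$. Let $W\sim N(0,\sigma^2I_{n\times n})$ be independent of $\mathbf{X}$, where $\sigma>0$ (which may depend on $n$), and for $\theta_0\in\mathbb{R}^p$ let $Y=\mathbf{X}\theta_0+W$. Let $\hat\theta^u$ be the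 debiased LASSO estimator computed from $(Y,\mathbf{X})$ with $\lambda=\sigma\sqrt{(c^2\log p)/n}$ and $\mu=a\sqrt{(\log p)/n}$, and let $\hat\sigma=\hat\sigma(Y,\mathbf{X})$ be an estimator of the noise level such that for every $\varepsilon>0$ $$\lim_{n\to\infty}\ \sup_{\theta_0\in\mathbb{R}^p:\ \|\theta_0\|_0\le s_0}\mathbb{P}\left(\left|\frac{\hat\sigma}{\sigma}-1\right|\ge\varepsilon\right)=0.$$ Then for every sequence of coordinates $i=i(n)\in\{1,\dots,p\}$ and every $x\in\mathbb{R}$, $$\lim_{n\to\infty}\ \sup_{\theta_0\in\mathbb{R}^p:\ \|\theta_0\|_0\le s_0}\left|\mathbb{P}\left(\frac{\sqrt n\,(\hat\theta^u_i-\theta_{0,i})}{\hat\sigma\,[M\hat\Sigma M^\top]_{ii}^{1/2}}\le x\right)-\Phi(x)\right|=0.$$ -/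

import Mathlib

open MeasureTheory ProbabilityTheory Filter Topology Asymptotics Matrix
open scoped ENNReal MatrixOrder Matrix.Norms.L2Operator

namespace DebiasedLasso

/-- Matrices carry the product (entrywise Borel) measurable structure. -/
instance instMeasurableSpaceMatrix {m n : Type*} : MeasurableSpace (Matrix m n ℝ) :=
  inferInstanceAs (MeasurableSpace (m → n → ℝ))

/-! ### Sub-Gaussian norms and designs -/

/-- The sub-Gaussian norm `sup_{q ≥ 1} q^{-1/2} (𝔼 |V|^q)^{1/q}` of a real random variable,
with value `∞` if the supremum is infinite. -/
noncomputable def subGaussianNorm {Ω : Type*} [MeasurableSpace Ω] (P : Measure Ω)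
    (V : Ω → ℝ) : ℝ≥0∞ :=
  ⨆ q : {q : ℝ // 1 ≤ q},
    ENNReal.ofReal (q.1 ^ (-(1 / 2) : ℝ)) * (∫⁻ ω, ENNReal.ofReal |V ω| ^ q.1 ∂P) ^ (1 / q.1)

/-- The sub-Gaussian norm of a random vector: the supremum over the Euclidean unit sphere of the
sub-Gaussian norms of its one-dimensional marginals. -/
noncomputable def subGaussianNormVec {Ω : Type*} [MeasurableSpace Ω] {p : ℕ} (P : Measure Ω)
    (V : Ω → Fin p → ℝ) : ℝ≥0∞ :=
  ⨆ u : {u : Fin p → ℝ // ∑ k, u k ^ 2 = 1}, subGaussianNorm P fun ω => V ω ⬝ᵥ u.1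

/-- `Σ^{-1/2}`, the inverse of the positive semidefinite square root. -/
noncomputable def invSqrt {p : ℕ} (S : Matrix (Fin p) (Fin p) ℝ) : Matrix (Fin p) (Fin p) ℝ :=
  (CFC.sqrt S)⁻¹

/-- The random design `X` (an `n × p` matrix) has population covariance `S`, with spectrum in
`[Cmin, Cmax]` and diagonal at most `1`, and `X S^{-1/2}` has independent sub-Gaussian rows with
zero mean and sub-Gaussian norm at most `κ`. -/
structure IsSubGaussianDesign {Ω : Type*} [MeasurableSpace Ω] {n p : ℕ} (P : Measure Ω)
    (X : Ω → Matrix (Fin n) (Fin p) ℝ) (S : Matrix (Fin p) (Fin p) ℝ)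
    (Cmin Cmax κ : ℝ) : Prop where
  measurable : Measurable X
  posSemidef : S.PosSemidef
  le_eigenvalues : ∀ k, Cmin ≤ posSemidef.isHermitian.eigenvalues k
  eigenvalues_le : ∀ k, posSemidef.isHermitian.eigenvalues k ≤ Cmax
  diag_le_one : ∀ k, S k k ≤ 1
  iIndepFun_rows : iIndepFun (fun (j : Fin n) ω => (X ω * invSqrt S) j) P
  mean_zero : ∀ j k, ∫ ω, (X ω * invSqrt S) j k ∂P = 0
  covariance : ∀ j k l, ∫ ω, X ω j k * X ω j l ∂P = S k l
  norm_rows_le : ∀ j,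
    subGaussianNormVec P (fun ω => (X ω * invSqrt S) j) ≤ ENNReal.ofReal κ

/-! ### The LASSO and the debiasing algorithm -/

/-- The LASSO objective `(1 / 2n) ‖y - X θ‖₂² + lam ‖θ‖₁`. -/
noncomputable def lassoObjective {n p : ℕ} (lam : ℝ) (y : Fin n → ℝ)
    (X : Matrix (Fin n) (Fin p) ℝ) (θ : Fin p → ℝ) : ℝ :=
  1 / (2 * (n : ℝ)) * ∑ j, (y j - (X *ᵥ θ) j) ^ 2 + lam * ∑ k, |θ k|

/-- `θ` is a LASSO estimate, i.e. a global minimizer of the LASSO objective. -/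
def IsLassoEstimate {n p : ℕ} (lam : ℝ) (y : Fin n → ℝ)
    (X : Matrix (Fin n) (Fin p) ℝ) (θ : Fin p → ℝ) : Prop :=
  ∀ θ' : Fin p → ℝ, lassoObjective lam y X θ ≤ lassoObjective lam y X θ'

/-- The sample covariance `Xᵀ X / n`. -/
noncomputable def sampleCov {n p : ℕ} (X : Matrix (Fin n) (Fin p) ℝ) :
    Matrix (Fin p) (Fin p) ℝ :=
  (1 / (n : ℝ)) • (Xᵀ * X)

/-- The constraint `‖S m - e_i‖_∞ ≤ μ`. -/
def IsFeasible {p : ℕ} (μ : ℝ) (S : Matrix (Fin p) (Fin p) ℝ) (i : Fin p) (m : Fin p → ℝ) :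
    Prop :=
  ∀ k, |(S *ᵥ m) k - (Pi.single i 1 : Fin p → ℝ) k| ≤ μ

/-- `m` solves: minimize `mᵀ S m` subject to `‖S m - e_i‖_∞ ≤ μ`. -/
def IsDebiasingRow {p : ℕ} (μ : ℝ) (S : Matrix (Fin p) (Fin p) ℝ) (i : Fin p)
    (m : Fin p → ℝ) : Prop :=
  IsFeasible μ S i m ∧ ∀ m', IsFeasible μ S i m' → m ⬝ᵥ (S *ᵥ m) ≤ m' ⬝ᵥ (S *ᵥ m')

/-- `M` is a possible debiasing matrix: its `i`-th row solves the `i`-th program if all the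
programs are feasible, and `M = I` otherwise. -/
def IsDebiasingMatrix {p : ℕ} (μ : ℝ) (S M : Matrix (Fin p) (Fin p) ℝ) : Prop :=
  ((∀ i, ∃ m, IsFeasible μ S i m) → ∀ i, IsDebiasingRow μ S i (M i)) ∧
  ((¬ ∀ i, ∃ m, IsFeasible μ S i m) → M = 1)

/-- The debiased estimate `θ + (1 / n) M Xᵀ (y - X θ)` built from an initial estimate `θ`. -/
noncomputable def debiased {n p : ℕ} (y : Fin n → ℝ) (X : Matrix (Fin n) (Fin p) ℝ)
    (M : Matrix (Fin p) (Fin p) ℝ) (θ : Fin p → ℝ) : Fin p → ℝ :=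
  θ + (1 / (n : ℝ)) • (M *ᵥ (Xᵀ *ᵥ (y - X *ᵥ θ)))

/-- The studentized statistic `√n (θᵘ_i - θ₀_i) / (s [M Σ̂ Mᵀ]_{ii}^{1/2})`. -/
noncomputable def studentized {n p : ℕ} (s : ℝ) (X : Matrix (Fin n) (Fin p) ℝ)
    (M : Matrix (Fin p) (Fin p) ℝ) (θu θ₀ : Fin p → ℝ) (i : Fin p) : ℝ :=
  √(n : ℝ) * (θu i - θ₀ i) / (s * √((M * sampleCov X * Mᵀ) i i))

/-- The vectors with at most `s` nonzero coordinates. -/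
abbrev SparseVec (p s : ℕ) : Type :=
  {θ : Fin p → ℝ // hammingNorm θ ≤ s}

end DebiasedLasso

open DebiasedLasso

namespace DebiasedLasso

/-! ### Exponential moments and Bernstein's inequality for products of sub-Gaussian variables -/

section Concentration

variable {Ω : Type*} [MeasurableSpace Ω] {P : Measure Ω}

/-! Put q = √(log p / n). Since Y = Xθ₀ + W, the error splits exactly (`debiased_sub_apply`):
√n(θᵘ_i − θ₀_i) = n^{-1/2}⟨X m_i, W⟩ − √n⟨Σ̂ m_i − e_i, θ̂ − θ₀⟩.

The first term is noise. The row m_i depends on X alone and W is independent of X, so after division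
by σ[MΣ̂Mᵀ]_ii^{1/2} its conditional law is exactly N(0,1) whenever X m_i ≠ 0; no central limit
theorem is needed (`measureReal_normalized_noise_le`).

The second term is bias. Hölder bounds it by √n μ‖θ̂ − θ₀‖₁, where μ = aq and the LASSO rate
`IsLassoEstimate.sum_abs_sub_le` gives ‖θ̂ − θ₀‖₁ = O(s₀σq). The product is of order σ s₀ log p/√n,
which is o(σ) by the sparsity assumption. Studentizing does not inflate it, because m_iᵀΣ̂m_i ≥ 1/8
(`IsFeasible.le_quadratic_form`).

Both parts rest on one event about X, `IsGoodDesign`, which `bernstein` and a union bound over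
entries make likely. Closeness of Σ̂ to Σ transfers strong convexity to the cone containing the
LASSO error; closeness of Σ̂Σ⁻¹ to I makes the columns of Σ⁻¹ feasible for the debiasing programs.

Replacing σ by σ̂ only rescales the threshold. `studentized_le_sandwich` is Slutsky's lemma done by
hand: it traps the event between Gaussian events with thresholds x ± (ε|x| + η), and continuity of Φ
closes the gap. Every bound is uniform over s₀-sparse θ₀, hence survives the supremum. -/

lemma exp_le_one_add_add_sq_mul (x : ℝ) :
    Real.exp x ≤ 1 + x + x ^ 2 * Real.exp |x| := by
  have h := Complex.norm_exp_sub_sum_le_norm_mul_exp (x : ℂ) 2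
  have h2 : Complex.exp (x : ℂ) - ∑ m ∈ Finset.range 2, (x : ℂ) ^ m / (m.factorial : ℂ)
      = ((Real.exp x - (1 + x) : ℝ) : ℂ) := by
    simp [Finset.sum_range_succ]
  rw [h2, Complex.norm_real, Complex.norm_real, Real.norm_eq_abs, Real.norm_eq_abs, sq_abs] at h
  linarith [le_abs_self (Real.exp x - (1 + x))]

lemma lintegral_even_pow_le {V : Ω → ℝ} {K : ℝ} (hK : 0 ≤ K)
    (h : subGaussianNorm P V ≤ ENNReal.ofReal K) {k : ℕ} (hk : 1 ≤ k) :
    ∫⁻ ω, ENNReal.ofReal (V ω ^ (2 * k)) ∂P ≤ ENNReal.ofReal ((2 * K ^ 2 * k) ^ k) := by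
  set q : ℝ := ((2 * k : ℕ) : ℝ) with hq
  have hk' : (1 : ℝ) ≤ k := by exact_mod_cast hk
  have hq1 : 1 ≤ q := by rw [hq]; push_cast; linarith
  have hq0 : 0 < q := by linarith
  have h1 := (le_iSup (fun q : {q : ℝ // 1 ≤ q} => ENNReal.ofReal (q.1 ^ (-(1 / 2) : ℝ)) *
    (∫⁻ ω, ENNReal.ofReal |V ω| ^ q.1 ∂P) ^ (1 / q.1)) ⟨q, hq1⟩).trans h
  simp only at h1
  have hI : ∫⁻ ω, ENNReal.ofReal |V ω| ^ q ∂P = ∫⁻ ω, ENNReal.ofReal (V ω ^ (2 * k)) ∂P := by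
    refine lintegral_congr fun ω => ?_
    rw [hq, ENNReal.rpow_natCast, ← ENNReal.ofReal_pow (abs_nonneg _), pow_mul, sq_abs, ← pow_mul]
  rw [hI] at h1
  set I := ∫⁻ ω, ENNReal.ofReal (V ω ^ (2 * k)) ∂P
  have h2 : I ^ (1 / q) ≤ ENNReal.ofReal (K * √q) := by
    have hs : 0 < √q := Real.sqrt_pos.2 hq0
    have e1 : (q ^ (-(1 / 2) : ℝ)) = (√q)⁻¹ := by
      rw [Real.rpow_neg hq0.le, Real.sqrt_eq_rpow]
    rw [e1] at h1
    calc I ^ (1 / q) = ENNReal.ofReal (√q) * (ENNReal.ofReal (√q)⁻¹ * I ^ (1 / q)) := by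
          rw [← mul_assoc, ← ENNReal.ofReal_mul hs.le, mul_inv_cancel₀ hs.ne', ENNReal.ofReal_one,
            one_mul]
      _ ≤ ENNReal.ofReal (√q) * ENNReal.ofReal K := by gcongr
      _ = ENNReal.ofReal (K * √q) := by rw [← ENNReal.ofReal_mul hs.le, mul_comm]
  calc I = (I ^ (1 / q)) ^ q := by
        rw [← ENNReal.rpow_mul, one_div_mul_cancel hq0.ne', ENNReal.rpow_one]
    _ ≤ ENNReal.ofReal (K * √q) ^ q := by gcongr
    _ = ENNReal.ofReal ((K * √q) ^ (2 * k)) := by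
        rw [hq, ENNReal.rpow_natCast, ← ENNReal.ofReal_pow (by positivity)]
    _ = ENNReal.ofReal ((2 * K ^ 2 * k) ^ k) := by
        rw [pow_mul, mul_pow, Real.sq_sqrt hq0.le, hq]; push_cast; ring_nf

/-- Integrate the exponential series termwise. The 2k-th moment is at most (2K²k)^k and k^k/k! ≤
e^k, so the k-th term is at most (2esK²)^k ≤ 2^{-k}; the geometric series sums to 2. -/
lemma lintegral_exp_sq_le [IsProbabilityMeasure P] {V : Ω → ℝ} (hV : Measurable V) {K s : ℝ}
    (hK : 0 ≤ K) (h : subGaussianNorm P V ≤ ENNReal.ofReal K) (hs : 0 ≤ s)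
    (hsK : 4 * Real.exp 1 * s * K ^ 2 ≤ 1) :
    ∫⁻ ω, ENNReal.ofReal (Real.exp (s * V ω ^ 2)) ∂P ≤ 2 := by
  have hexp : ∀ ω, ENNReal.ofReal (Real.exp (s * V ω ^ 2))
      = ∑' k : ℕ, ENNReal.ofReal (s ^ k / k.factorial) * ENNReal.ofReal (V ω ^ (2 * k)) := by
    intro ω
    have hsum := NormedSpace.expSeries_div_hasSum_exp (s * V ω ^ 2)
    rw [← Real.exp_eq_exp_ℝ] at hsum
    rw [← hsum.tsum_eq, ENNReal.ofReal_tsum_of_nonneg (fun k => by positivity) hsum.summable]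
    refine tsum_congr fun k => ?_
    rw [← ENNReal.ofReal_mul (by positivity), mul_pow, pow_mul]
    ring_nf
  simp_rw [hexp]
  rw [lintegral_tsum (fun k => by fun_prop)]
  have hterm : ∀ k : ℕ, ∫⁻ ω, ENNReal.ofReal (s ^ k / k.factorial) *
      ENNReal.ofReal (V ω ^ (2 * k)) ∂P ≤ 2⁻¹ ^ k := by
    intro k
    rw [lintegral_const_mul _ (by fun_prop)]
    rcases Nat.eq_zero_or_pos k with rfl | hk
    · simp
    · calc _ ≤ ENNReal.ofReal (s ^ k / k.factorial) * ENNReal.ofReal ((2 * K ^ 2 * k) ^ k) := by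
            gcongr; exact lintegral_even_pow_le hK h hk
        _ = ENNReal.ofReal ((s * (2 * K ^ 2)) ^ k * ((k : ℝ) ^ k / k.factorial)) := by
            rw [← ENNReal.ofReal_mul (by positivity)]; congr 1; ring
        _ ≤ ENNReal.ofReal ((s * (2 * K ^ 2)) ^ k * Real.exp k) := by
            gcongr; exact Real.pow_div_factorial_le_exp _ (by positivity) k
        _ = ENNReal.ofReal ((s * (2 * K ^ 2) * Real.exp 1) ^ k) := by
            rw [mul_pow _ (Real.exp 1), ← Real.exp_nat_mul, mul_one]
        _ ≤ ENNReal.ofReal ((2⁻¹ : ℝ) ^ k) := by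
            gcongr; linarith
        _ = 2⁻¹ ^ k := by
            rw [ENNReal.ofReal_pow (by positivity), ENNReal.ofReal_inv_of_pos (by norm_num)]
            simp
  calc _ ≤ ∑' k : ℕ, (2⁻¹ : ℝ≥0∞) ^ k := ENNReal.tsum_le_tsum hterm
    _ = 2 := by rw [ENNReal.tsum_geometric, ENNReal.one_sub_inv_two, inv_inv]

lemma lintegral_exp_abs_mul_le [IsProbabilityMeasure P] {A B : Ω → ℝ} (hA : Measurable A)
    (hB : Measurable B) {K s : ℝ} (hK : 0 ≤ K) (hAK : subGaussianNorm P A ≤ ENNReal.ofReal K)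
    (hBK : subGaussianNorm P B ≤ ENNReal.ofReal K) (hs : 0 ≤ s)
    (hsK : 4 * Real.exp 1 * s * K ^ 2 ≤ 1) :
    ∫⁻ ω, ENNReal.ofReal (Real.exp (s * |A ω * B ω|)) ∂P ≤ 2 := by
  have hpt : ∀ ω, ENNReal.ofReal (Real.exp (s * |A ω * B ω|)) ≤
      2⁻¹ * (ENNReal.ofReal (Real.exp (s * A ω ^ 2)) +
        ENNReal.ofReal (Real.exp (s * B ω ^ 2))) := by
    intro ω
    have h2 : (2⁻¹ : ℝ≥0∞) = ENNReal.ofReal 2⁻¹ := by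
      rw [ENNReal.ofReal_inv_of_pos (by norm_num)]; simp
    rw [h2, ← ENNReal.ofReal_add (by positivity) (by positivity),
      ← ENNReal.ofReal_mul (by positivity)]
    apply ENNReal.ofReal_le_ofReal
    have h3 : s * |A ω * B ω| ≤ s * A ω ^ 2 / 2 + s * B ω ^ 2 / 2 := by
      rw [abs_mul]
      nlinarith [mul_nonneg hs (sq_nonneg (|A ω| - |B ω|)), sq_abs (A ω), sq_abs (B ω)]
    have h4 : Real.exp (s * A ω ^ 2) = Real.exp (s * A ω ^ 2 / 2) ^ 2 := by
      rw [← Real.exp_nat_mul]; congr 1; push_cast; ring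
    have h5 : Real.exp (s * B ω ^ 2) = Real.exp (s * B ω ^ 2 / 2) ^ 2 := by
      rw [← Real.exp_nat_mul]; congr 1; push_cast; ring
    refine (Real.exp_le_exp.2 h3).trans ?_
    rw [Real.exp_add, h4, h5]
    nlinarith [sq_nonneg (Real.exp (s * A ω ^ 2 / 2) - Real.exp (s * B ω ^ 2 / 2))]
  calc _ ≤ ∫⁻ ω, 2⁻¹ * (ENNReal.ofReal (Real.exp (s * A ω ^ 2)) +
        ENNReal.ofReal (Real.exp (s * B ω ^ 2))) ∂P := lintegral_mono hpt
    _ = 2⁻¹ * (∫⁻ ω, ENNReal.ofReal (Real.exp (s * A ω ^ 2)) ∂P +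
        ∫⁻ ω, ENNReal.ofReal (Real.exp (s * B ω ^ 2)) ∂P) := by
        rw [lintegral_const_mul _ (by fun_prop), lintegral_add_left (by fun_prop)]
    _ ≤ 2⁻¹ * (2 + 2) := by
        gcongr
        · exact lintegral_exp_sq_le hA hK hAK hs hsK
        · exact lintegral_exp_sq_le hB hK hBK hs hsK
    _ = 2 := by
        rw [mul_add, ENNReal.inv_mul_cancel (by norm_num) (by norm_num)]; norm_num

lemma integrable_exp_abs {V : Ω → ℝ} (hV : Measurable V) {s : ℝ}
    (h : ∫⁻ ω, ENNReal.ofReal (Real.exp (s * |V ω|)) ∂P ≤ 2) :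
    Integrable (fun ω => Real.exp (s * |V ω|)) P := by
  refine ⟨by fun_prop, ?_⟩
  rw [hasFiniteIntegral_iff_ofReal (ae_of_all _ fun ω => (Real.exp_pos _).le)]
  exact h.trans_lt (by norm_num)

lemma integral_exp_abs_le {V : Ω → ℝ} (hV : Measurable V) {s : ℝ}
    (h : ∫⁻ ω, ENNReal.ofReal (Real.exp (s * |V ω|)) ∂P ≤ 2) :
    ∫ ω, Real.exp (s * |V ω|) ∂P ≤ 2 := by
  rw [integral_eq_lintegral_of_nonneg_ae (ae_of_all _ fun ω => (Real.exp_pos _).le)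
    (by fun_prop)]
  exact ENNReal.toReal_le_of_le_ofReal (by norm_num) (by simpa using h)

lemma integrable_of_lintegral_exp_abs_le {V : Ω → ℝ} (hV : Measurable V) {s : ℝ} (hs : 0 < s)
    (h : ∫⁻ ω, ENNReal.ofReal (Real.exp (s * |V ω|)) ∂P ≤ 2) : Integrable V P := by
  refine ((integrable_exp_abs hV h).const_mul s⁻¹).mono' (by fun_prop) (ae_of_all _ fun ω => ?_)
  rw [Real.norm_eq_abs, ← div_eq_inv_mul, le_div_iff₀ hs]
  linarith [Real.add_one_le_exp (s * |V ω|)]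

/-- Second-order expansion of the exponential: centering kills the linear term, and for |t| ≤ s/2
the quadratic remainder is dominated by (8t²/s²)e^{s|V − m|}. -/
lemma mgf_centered_le [IsProbabilityMeasure P] {V : Ω → ℝ} (hV : Measurable V) {s t : ℝ}
    (hs : 0 < s) (h : ∫⁻ ω, ENNReal.ofReal (Real.exp (s * |V ω|)) ∂P ≤ 2) (ht : |t| ≤ s / 2) :
    Integrable (fun ω => Real.exp (t * (V ω - ∫ ω', V ω' ∂P))) P ∧
      mgf (fun ω => V ω - ∫ ω', V ω' ∂P) P t ≤ Real.exp (44 * t ^ 2 / s ^ 2) := by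
  have hint := integrable_exp_abs hV h
  have hle := integral_exp_abs_le hV h
  have hVint := integrable_of_lintegral_exp_abs_le hV hs h
  set m := ∫ ω', V ω' ∂P with hm
  -- From s|V| ≤ e^{s|V|} − 1. Thus centering costs at most a factor e in the exponential moment.
  have hm1 : s * |m| ≤ 1 := by
    have h1 : |m| ≤ ∫ ω, |V ω| ∂P := abs_integral_le_integral_abs
    have h2 : s * ∫ ω, |V ω| ∂P ≤ ∫ ω, (Real.exp (s * |V ω|) - 1) ∂P := by
      rw [← integral_const_mul]
      refine integral_mono (hVint.abs.const_mul s) (hint.sub (integrable_const _)) fun ω => ?_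
      simp only
      linarith [Real.add_one_le_exp (s * |V ω|)]
    rw [integral_sub hint (integrable_const _)] at h2
    simp only [integral_const, probReal_univ, smul_eq_mul, mul_one] at h2
    nlinarith
  have hpt : ∀ ω, Real.exp (s * |V ω - m|) ≤ Real.exp 1 * Real.exp (s * |V ω|) := by
    intro ω
    rw [← Real.exp_add, Real.exp_le_exp]
    have : |V ω - m| ≤ |V ω| + |m| := abs_sub _ _
    nlinarith
  have hY : Integrable (fun ω => Real.exp (s * |V ω - m|)) P :=
    (hint.const_mul (Real.exp 1)).mono' (by fun_prop) (ae_of_all _ fun ω => by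
      rw [Real.norm_eq_abs, abs_of_pos (Real.exp_pos _)]; exact hpt ω)
  have hYle : ∫ ω, Real.exp (s * |V ω - m|) ∂P ≤ 2 * Real.exp 1 := by
    calc _ ≤ ∫ ω, Real.exp 1 * Real.exp (s * |V ω|) ∂P :=
          integral_mono hY (hint.const_mul _) hpt
      _ ≤ 2 * Real.exp 1 := by
          rw [integral_const_mul]; nlinarith [Real.exp_pos 1]
  have habs : ∀ y : ℝ, |t * y| ≤ s / 2 * |y| := fun y => by
    rw [abs_mul]; gcongr
  have hI : Integrable (fun ω => Real.exp (t * (V ω - m))) P := by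
    refine hY.mono' (by fun_prop) (ae_of_all _ fun ω => ?_)
    rw [Real.norm_eq_abs, abs_of_pos (Real.exp_pos _), Real.exp_le_exp]
    nlinarith [habs (V ω - m), le_abs_self (t * (V ω - m)), abs_nonneg (V ω - m)]
  refine ⟨hI, ?_⟩
  have hbound : ∀ ω, Real.exp (t * (V ω - m)) ≤
      1 + t * (V ω - m) + 8 * t ^ 2 / s ^ 2 * Real.exp (s * |V ω - m|) := by
    intro ω
    set y := V ω - m
    refine (exp_le_one_add_add_sq_mul (t * y)).trans ?_
    have h1 : Real.exp |t * y| ≤ Real.exp (s / 2 * |y|) := Real.exp_le_exp.2 (habs y)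
    have h2 : (s / 2 * |y|) ^ 2 ≤ 2 * Real.exp (s / 2 * |y|) := by
      have := Real.quadratic_le_exp_of_nonneg (x := s / 2 * |y|) (by positivity)
      nlinarith [mul_nonneg hs.le (abs_nonneg y)]
    have h3 : Real.exp (s * |y|) = Real.exp (s / 2 * |y|) * Real.exp (s / 2 * |y|) := by
      rw [← Real.exp_add]; congr 1; ring
    have h4 : (t * y) ^ 2 = 4 * t ^ 2 / s ^ 2 * (s / 2 * |y|) ^ 2 := by
      rw [mul_pow, mul_pow, sq_abs]; field_simp; ring
    have h5 : (t * y) ^ 2 * Real.exp |t * y| ≤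
        (4 * t ^ 2 / s ^ 2 * (2 * Real.exp (s / 2 * |y|))) * Real.exp (s / 2 * |y|) := by
      rw [h4]; gcongr
    have h6 : 8 * t ^ 2 / s ^ 2 * Real.exp (s * |y|) =
        (4 * t ^ 2 / s ^ 2 * (2 * Real.exp (s / 2 * |y|))) * Real.exp (s / 2 * |y|) := by
      rw [h3]; ring
    linarith
  have hYi : Integrable (fun ω => V ω - m) P := hVint.sub (integrable_const _)
  have hmean : ∫ ω, (V ω - m) ∂P = 0 := by
    rw [integral_sub hVint (integrable_const _)]; simp [hm]
  have h1i : Integrable (fun ω => 1 + t * (V ω - m)) P :=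
    (integrable_const _).add (hYi.const_mul _)
  calc mgf (fun ω => V ω - m) P t
      ≤ ∫ ω, (1 + t * (V ω - m) + 8 * t ^ 2 / s ^ 2 * Real.exp (s * |V ω - m|)) ∂P :=
        integral_mono hI (h1i.add (hY.const_mul _)) hbound
    _ = 1 + 8 * t ^ 2 / s ^ 2 * ∫ ω, Real.exp (s * |V ω - m|) ∂P := by
        rw [integral_add h1i (hY.const_mul _), integral_add (integrable_const _)
          (hYi.const_mul _), integral_const_mul, integral_const_mul, hmean]
        simp
    _ ≤ 1 + 8 * t ^ 2 / s ^ 2 * (2 * Real.exp 1) := by gcongr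
    -- The constant 44 is 8 · 2e ≈ 43.5 rounded up.
    _ ≤ 1 + 44 * t ^ 2 / s ^ 2 := by
        have h0 : 0 ≤ t ^ 2 / s ^ 2 := by positivity
        have := Real.exp_one_lt_d9
        rw [mul_div_assoc, mul_div_assoc]
        nlinarith
    _ ≤ Real.exp (44 * t ^ 2 / s ^ 2) := by linarith [Real.add_one_le_exp (44 * t ^ 2 / s ^ 2)]

/-- Chernoff's bound. The factor `Real.sign t` lets one statement serve both tails, through t and
−t. -/
lemma measure_sum_centered_ge_le [IsProbabilityMeasure P] {n : ℕ} {V : Fin n → Ω → ℝ}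
    (hV : ∀ j, Measurable (V j)) (hind : iIndepFun V P) {s τ t : ℝ} (hs : 0 < s)
    (h : ∀ j, ∫⁻ ω, ENNReal.ofReal (Real.exp (s * |V j ω|)) ∂P ≤ 2) (ht : |t| ≤ s / 2) :
    P.real {ω | n * τ ≤ Real.sign t * ∑ j, (V j ω - ∫ ω', V j ω' ∂P)} ≤
      Real.exp (n * (44 * t ^ 2 / s ^ 2 - |t| * τ)) := by
  set Y : Fin n → Ω → ℝ := fun j ω => V j ω - ∫ ω', V j ω' ∂P with hY
  have hYm : ∀ j, Measurable (Y j) := fun j => (hV j).sub_const _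
  have hYind : iIndepFun Y P :=
    hind.comp (fun j x => x - ∫ ω', V j ω' ∂P) (fun j => measurable_id.sub_const _)
  have hint := hYind.integrable_exp_mul_sum (t := t) hYm (s := Finset.univ)
    (fun j _ => (mgf_centered_le (hV j) hs (h j) ht).1)
  have hmgf : mgf (∑ j, Y j) P t ≤ Real.exp (n * (44 * t ^ 2 / s ^ 2)) := by
    rw [hYind.mgf_sum hYm, Real.exp_nat_mul]
    calc _ ≤ ∏ j : Fin n, Real.exp (44 * t ^ 2 / s ^ 2) :=
          Finset.prod_le_prod (fun j _ => mgf_nonneg)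
            (fun j _ => (mgf_centered_le (hV j) hs (h j) ht).2)
      _ = _ := by simp
  have hsub : {ω | n * τ ≤ Real.sign t * ∑ j, Y j ω} ⊆
      {ω | |t| * (n * τ) ≤ t * (∑ j, Y j) ω} := by
    intro ω hω
    simp only [Set.mem_ofPred_eq, Finset.sum_apply] at hω ⊢
    have h1 : t * ∑ j, Y j ω = |t| * (Real.sign t * ∑ j, Y j ω) := by
      rw [← mul_assoc]; congr 1
      rcases lt_trichotomy t 0 with ht | rfl | ht
      · rw [Real.sign_of_neg ht, abs_of_neg ht]; ring
      · simp
      · rw [Real.sign_of_pos ht, abs_of_pos ht]; ring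
    rw [h1]
    gcongr
  have hint' : Integrable (fun ω => Real.exp (1 * (t * (∑ j, Y j) ω))) P := by simpa using hint
  calc _ ≤ P.real {ω | |t| * (n * τ) ≤ t * (∑ j, Y j) ω} := measureReal_mono hsub
    _ ≤ Real.exp (-1 * (|t| * (n * τ))) * mgf (fun ω => t * (∑ j, Y j) ω) P 1 :=
        measure_ge_le_exp_mul_mgf _ zero_le_one hint'
    _ ≤ Real.exp (-1 * (|t| * (n * τ))) * Real.exp (n * (44 * t ^ 2 / s ^ 2)) := by
        rw [mgf_const_mul, mul_one]; gcongr
    _ = _ := by rw [← Real.exp_add]; congr 1; ring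

/-- A Bernstein inequality for independent sub-exponential random variables. -/
lemma bernstein [IsProbabilityMeasure P] {n : ℕ} {V : Fin n → Ω → ℝ}
    (hV : ∀ j, Measurable (V j)) (hind : iIndepFun V P) {s τ : ℝ} (hs : 0 < s) (hτ : 0 < τ)
    (hsτ : s * τ ≤ 44) (h : ∀ j, ∫⁻ ω, ENNReal.ofReal (Real.exp (s * |V j ω|)) ∂P ≤ 2) :
    P.real {ω | n * τ ≤ |∑ j, (V j ω - ∫ ω', V j ω' ∂P)|} ≤
      2 * Real.exp (-(n * τ ^ 2 * s ^ 2 / 176)) := by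
  -- The minimizer of 44t²/s² − tτ; `hsτ` is exactly what keeps it within s/2.
  set t := τ * s ^ 2 / 88 with ht
  have ht0 : 0 < t := by positivity
  have ht1 : |t| ≤ s / 2 := by
    rw [abs_of_pos ht0, ht]; nlinarith
  have h1 := measure_sum_centered_ge_le (τ := τ) hV hind hs h ht1
  have h2 := measure_sum_centered_ge_le (τ := τ) hV hind hs h (t := -t) (by rwa [abs_neg])
  have he : n * (44 * t ^ 2 / s ^ 2 - |t| * τ) = -(n * τ ^ 2 * s ^ 2 / 176) := by
    rw [abs_of_pos ht0, ht]; field_simp; ring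
  rw [abs_neg, neg_sq, he, Real.sign_of_neg (neg_lt_zero.2 ht0)] at h2
  rw [he, Real.sign_of_pos ht0] at h1
  calc _ ≤ P.real ({ω | n * τ ≤ 1 * ∑ j, (V j ω - ∫ ω', V j ω' ∂P)} ∪
        {ω | n * τ ≤ -1 * ∑ j, (V j ω - ∫ ω', V j ω' ∂P)}) := by
        refine measureReal_mono fun ω hω => ?_
        simp only [Set.mem_ofPred_eq, Set.mem_union] at hω ⊢
        rcases le_abs.1 hω with h | h
        · left; linarith
        · right; linarith
    _ ≤ _ := measureReal_union_le _ _
    _ ≤ _ := by linarith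

end Concentration

/-! ### Spectral bounds and the square root of the covariance -/

section Spectral

variable {p : ℕ} {S : Matrix (Fin p) (Fin p) ℝ}

lemma mul_sum_sq_le_quadratic_form (hS : S.PosSemidef) {c : ℝ}
    (hc : ∀ k, c ≤ hS.isHermitian.eigenvalues k) (v : Fin p → ℝ) :
    c * ∑ k, v k ^ 2 ≤ v ⬝ᵥ (S *ᵥ v) := by
  have h : algebraMap ℝ (Matrix (Fin p) (Fin p) ℝ) c ≤ S := by
    rw [algebraMap_le_iff_le_spectrum (ha := hS.isHermitian)]
    intro x hx
    rw [hS.isHermitian.spectrum_real_eq_range_eigenvalues] at hx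
    obtain ⟨k, rfl⟩ := hx
    exact hc k
  have h2 := (Matrix.le_iff.1 h).dotProduct_mulVec_nonneg v
  rw [Matrix.sub_mulVec, dotProduct_sub, Algebra.algebraMap_eq_smul_one, Matrix.smul_mulVec,
    Matrix.one_mulVec, dotProduct_smul] at h2
  simp only [star_trivial, smul_eq_mul] at h2
  have h3 : v ⬝ᵥ v = ∑ k, v k ^ 2 := by simp [dotProduct, sq]
  rw [h3] at h2
  linarith

lemma sqrt_mul_sqrt_of_posSemidef (hS : S.PosSemidef) : CFC.sqrt S * CFC.sqrt S = S :=
  CFC.sqrt_mul_sqrt_self S hS.nonneg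

lemma sqrt_transpose : (CFC.sqrt S)ᵀ = CFC.sqrt S := by
  have h := (CFC.sqrt_nonneg S).isSelfAdjoint
  rwa [IsSelfAdjoint, Matrix.star_eq_conjTranspose,
    Matrix.conjTranspose_eq_transpose_of_trivial] at h

lemma isUnit_det_sqrt (hS : S.PosDef) : IsUnit (CFC.sqrt S).det := by
  rw [isUnit_iff_ne_zero]
  intro h0
  have h := congrArg Matrix.det (sqrt_mul_sqrt_of_posSemidef hS.posSemidef)
  rw [Matrix.det_mul, h0, mul_zero] at h
  exact hS.det_pos.ne h

lemma posDef_of_le_eigenvalues (hS : S.PosSemidef) {c : ℝ} (hc0 : 0 < c)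
    (hc : ∀ k, c ≤ hS.isHermitian.eigenvalues k) : S.PosDef :=
  hS.isHermitian.posDef_iff_eigenvalues_pos.2 fun k => hc0.trans_le (hc k)

/-- A design entry is the whitened row paired with a column of √S; this gives that column's length.
-/
lemma sum_sq_sqrt (hS : S.PosSemidef) (k : Fin p) : ∑ m, CFC.sqrt S m k ^ 2 = S k k := by
  conv_rhs => rw [← sqrt_mul_sqrt_of_posSemidef hS, Matrix.mul_apply]
  refine Finset.sum_congr rfl fun m _ => ?_
  rw [sq]; congr 1
  conv_lhs => rw [← sqrt_transpose, Matrix.transpose_apply]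

lemma invSqrt_transpose : (invSqrt S)ᵀ = invSqrt S := by
  rw [invSqrt, Matrix.transpose_nonsing_inv, sqrt_transpose]

lemma invSqrt_mul_invSqrt (hS : S.PosSemidef) : invSqrt S * invSqrt S = S⁻¹ := by
  rw [invSqrt, ← Matrix.mul_inv_rev, sqrt_mul_sqrt_of_posSemidef hS]

/-- Test the lower spectral bound on m = S⁻¹e_k: c·m_k² ≤ c‖m‖² ≤ mᵀSm = m_k. -/
lemma inv_diag_le (hS : S.PosSemidef) {c : ℝ} (hc0 : 0 < c)
    (hc : ∀ k, c ≤ hS.isHermitian.eigenvalues k) (k : Fin p) : S⁻¹ k k ≤ 1 / c := by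
  have hdet : IsUnit S.det := (posDef_of_le_eigenvalues hS hc0 hc).det_pos.ne'.isUnit
  set m : Fin p → ℝ := S⁻¹ *ᵥ Pi.single k 1 with hm
  have hmk : m k = S⁻¹ k k := by simp [hm]
  have h1 := mul_sum_sq_le_quadratic_form hS hc m
  have h2 : S *ᵥ m = Pi.single k 1 := by
    rw [hm, Matrix.mulVec_mulVec, Matrix.mul_nonsing_inv _ hdet, Matrix.one_mulVec]
  rw [h2, dotProduct_single, mul_one] at h1
  have h3 : m k ^ 2 ≤ ∑ l, m l ^ 2 :=
    Finset.single_le_sum (f := fun l => m l ^ 2) (fun _ _ => sq_nonneg _) (Finset.mem_univ k)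
  rw [← hmk, le_div_iff₀ hc0]
  by_contra! hlt
  have hpos : 0 < m k := by by_contra! h; nlinarith
  nlinarith [mul_le_mul_of_nonneg_left h3 hc0.le]

lemma sum_sq_invSqrt (hS : S.PosSemidef) (k : Fin p) :
    ∑ m, invSqrt S m k ^ 2 = S⁻¹ k k := by
  rw [← invSqrt_mul_invSqrt hS, Matrix.mul_apply]
  refine Finset.sum_congr rfl fun m _ => ?_
  rw [sq]; congr 1
  conv_lhs => rw [← invSqrt_transpose, Matrix.transpose_apply]

end Spectral

/-! ### Concentration of the sample covariance -/

section Design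

variable {Ω : Type*} [MeasurableSpace Ω] {P : Measure Ω}

lemma subGaussianNorm_const_mul_le {V : Ω → ℝ} (hV : Measurable V) (c : ℝ) :
    subGaussianNorm P (fun ω => c * V ω) ≤ ENNReal.ofReal |c| * subGaussianNorm P V := by
  refine iSup_le fun q => ?_
  have hq0 : (0 : ℝ) < q.1 := by linarith [q.2]
  calc _ = ENNReal.ofReal |c| * (ENNReal.ofReal (q.1 ^ (-(1 / 2) : ℝ)) *
        (∫⁻ ω, ENNReal.ofReal |V ω| ^ q.1 ∂P) ^ (1 / q.1)) := by
        have h : ∀ ω, ENNReal.ofReal |c * V ω| ^ q.1 =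
            ENNReal.ofReal |c| ^ q.1 * ENNReal.ofReal |V ω| ^ q.1 := fun ω => by
          rw [abs_mul, ENNReal.ofReal_mul (abs_nonneg _), ENNReal.mul_rpow_of_nonneg _ _ hq0.le]
        simp_rw [h]
        rw [lintegral_const_mul _ (by fun_prop), ENNReal.mul_rpow_of_nonneg _ _ (by positivity),
          ← ENNReal.rpow_mul, mul_one_div_cancel hq0.ne', ENNReal.rpow_one]
        ring
    _ ≤ _ := by
        gcongr
        exact le_iSup (fun q : {q : ℝ // 1 ≤ q} => ENNReal.ofReal (q.1 ^ (-(1 / 2) : ℝ)) *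
          (∫⁻ ω, ENNReal.ofReal |V ω| ^ q.1 ∂P) ^ (1 / q.1)) q

/-- Homogeneity reduces to a unit vector; u = 0 is treated apart since it cannot be normalized. -/
lemma subGaussianNorm_dotProduct_le {p : ℕ} {Z : Ω → Fin p → ℝ} (hZ : Measurable Z) {κ b : ℝ}
    (h : subGaussianNormVec P Z ≤ ENNReal.ofReal κ) {u : Fin p → ℝ} (hb : 0 ≤ b)
    (hu : ∑ k, u k ^ 2 ≤ b ^ 2) :
    subGaussianNorm P (fun ω => Z ω ⬝ᵥ u) ≤ ENNReal.ofReal (κ * b) := by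
  set r := √(∑ k, u k ^ 2) with hr
  have hr2 : r ^ 2 = ∑ k, u k ^ 2 := Real.sq_sqrt (Finset.sum_nonneg fun _ _ => sq_nonneg _)
  have hr0 : 0 ≤ r := Real.sqrt_nonneg _
  have hrb : r ≤ b := abs_le_of_sq_le_sq' (by linarith) hb |>.2
  have hmeas : ∀ w : Fin p → ℝ, Measurable fun ω => Z ω ⬝ᵥ w := fun w => by
    simp only [dotProduct]; fun_prop
  rcases hr0.eq_or_lt with h0 | hpos
  · have hu0 : u = 0 := by
      funext k
      rw [← h0] at hr2
      have := (Finset.sum_eq_zero_iff_of_nonneg (fun k _ => sq_nonneg (u k))).1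
        (hr2.symm.trans (by norm_num)) k (Finset.mem_univ k)
      simpa using this
    have := subGaussianNorm_const_mul_le (P := P) (V := fun _ => 0) measurable_const 0
    simp only [abs_zero, ENNReal.ofReal_zero, zero_mul, nonpos_iff_eq_zero] at this
    simp [hu0, this]
  · have hunit : ∑ k, ((r⁻¹ • u) k) ^ 2 = 1 := by
      simp only [Pi.smul_apply, smul_eq_mul, mul_pow]
      rw [← Finset.mul_sum, ← hr2, ← mul_pow, inv_mul_cancel₀ hpos.ne', one_pow]
    have h1 := (le_iSup (fun w : {u : Fin p → ℝ // ∑ k, u k ^ 2 = 1} =>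
      subGaussianNorm P fun ω => Z ω ⬝ᵥ w.1) ⟨r⁻¹ • u, hunit⟩).trans h
    have h2 : (fun ω => Z ω ⬝ᵥ u) = fun ω => r * (Z ω ⬝ᵥ (r⁻¹ • u)) := by
      funext ω
      rw [dotProduct_smul, smul_eq_mul, ← mul_assoc, mul_inv_cancel₀ hpos.ne', one_mul]
    rw [h2]
    calc _ ≤ ENNReal.ofReal |r| * subGaussianNorm P (fun ω => Z ω ⬝ᵥ (r⁻¹ • u)) :=
          subGaussianNorm_const_mul_le (hmeas _) r
      _ ≤ ENNReal.ofReal b * ENNReal.ofReal κ := by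
          rw [abs_of_pos hpos]; gcongr
      _ = _ := by rw [← ENNReal.ofReal_mul hb, mul_comm]

lemma measurable_matrix_apply {m n : Type*} {X : Ω → Matrix m n ℝ} (hX : Measurable X)
    (j : m) (k : n) : Measurable fun ω => X ω j k :=
  (measurable_pi_apply k).comp ((measurable_pi_apply j).comp hX)

namespace IsSubGaussianDesign

variable {n p : ℕ} {X : Ω → Matrix (Fin n) (Fin p) ℝ} {S : Matrix (Fin p) (Fin p) ℝ}
  {Cmin Cmax κ : ℝ}

lemma measurable_row (hD : IsSubGaussianDesign P X S Cmin Cmax κ) (j : Fin n) :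
    Measurable fun ω => (X ω * invSqrt S) j := by
  refine measurable_pi_lambda _ fun k => ?_
  simp only [Matrix.mul_apply]
  exact Finset.measurable_sum _ fun m _ =>
    (measurable_matrix_apply hD.measurable j m).mul_const _

lemma lintegral_exp_le [IsProbabilityMeasure P] (hD : IsSubGaussianDesign P X S Cmin Cmax κ)
    (hκ : 0 ≤ κ) {b s : ℝ} (hb : 0 ≤ b) {u v : Fin p → ℝ} (hu : ∑ k, u k ^ 2 ≤ b ^ 2)
    (hv : ∑ k, v k ^ 2 ≤ b ^ 2) (hs : 0 ≤ s) (hsκ : 4 * Real.exp 1 * s * (κ * b) ^ 2 ≤ 1)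
    (j : Fin n) :
    ∫⁻ ω, ENNReal.ofReal (Real.exp (s * |((X ω * invSqrt S) j ⬝ᵥ u) *
      ((X ω * invSqrt S) j ⬝ᵥ v)|)) ∂P ≤ 2 := by
  have hrow := hD.measurable_row j
  have hmeas : ∀ w : Fin p → ℝ, Measurable fun ω => (X ω * invSqrt S) j ⬝ᵥ w := fun w => by
    simp only [dotProduct]
    exact Finset.measurable_sum _ fun m _ => (measurable_pi_iff.1 hrow m).mul_const _
  exact lintegral_exp_abs_mul_le (hmeas u) (hmeas v) (by positivity)
    (subGaussianNorm_dotProduct_le hrow (hD.norm_rows_le j) hb hu)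
    (subGaussianNorm_dotProduct_le hrow (hD.norm_rows_le j) hb hv) hs hsκ

lemma measure_le_abs_sum [IsProbabilityMeasure P] (hD : IsSubGaussianDesign P X S Cmin Cmax κ)
    (hκ : 0 ≤ κ) {b s τ : ℝ} (hb : 0 ≤ b) {u v : Fin p → ℝ} (hu : ∑ k, u k ^ 2 ≤ b ^ 2)
    (hv : ∑ k, v k ^ 2 ≤ b ^ 2) (hs : 0 < s) (hsκ : 4 * Real.exp 1 * s * (κ * b) ^ 2 ≤ 1)
    (hτ : 0 < τ) (hsτ : s * τ ≤ 44) {e : ℝ}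
    (he : ∀ j, ∫ ω, ((X ω * invSqrt S) j ⬝ᵥ u) * ((X ω * invSqrt S) j ⬝ᵥ v) ∂P = e) :
    P.real {ω | n * τ ≤ |∑ j, (((X ω * invSqrt S) j ⬝ᵥ u) * ((X ω * invSqrt S) j ⬝ᵥ v) - e)|} ≤
      2 * Real.exp (-(n * τ ^ 2 * s ^ 2 / 176)) := by
  have hg : Measurable fun z : Fin p → ℝ => (z ⬝ᵥ u) * (z ⬝ᵥ v) := by
    simp only [dotProduct]; fun_prop
  have hind := hD.iIndepFun_rows.comp (fun _ z => (z ⬝ᵥ u) * (z ⬝ᵥ v)) (fun _ => hg)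
  have := bernstein (fun j => hg.comp (hD.measurable_row j)) hind hs hτ hsτ
    (fun j => hD.lintegral_exp_le hκ hb hu hv hs.le hsκ j)
  simpa only [Function.comp_def, he] using this

lemma posDef (hD : IsSubGaussianDesign P X S Cmin Cmax κ) (hC : 0 < Cmin) : S.PosDef :=
  posDef_of_le_eigenvalues hD.posSemidef hC hD.le_eigenvalues

lemma apply_eq_dotProduct (hD : IsSubGaussianDesign P X S Cmin Cmax κ) (hC : 0 < Cmin)
    (ω : Ω) (j : Fin n) (k : Fin p) :
    X ω j k = (X ω * invSqrt S) j ⬝ᵥ fun m => CFC.sqrt S m k := by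
  have h : X ω * invSqrt S * CFC.sqrt S = X ω := by
    rw [invSqrt, Matrix.nonsing_inv_mul_cancel_right _ _ (isUnit_det_sqrt (hD.posDef hC))]
  conv_lhs => rw [← h]
  rfl

lemma mul_inv_apply_eq_dotProduct (hD : IsSubGaussianDesign P X S Cmin Cmax κ)
    (ω : Ω) (j : Fin n) (k : Fin p) :
    (X ω * S⁻¹) j k = (X ω * invSqrt S) j ⬝ᵥ fun m => invSqrt S m k := by
  rw [← invSqrt_mul_invSqrt hD.posSemidef, ← Matrix.mul_assoc]
  rfl

end IsSubGaussianDesign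

lemma sampleCov_apply {n p : ℕ} (x : Matrix (Fin n) (Fin p) ℝ) (k l : Fin p) :
    sampleCov x k l = 1 / (n : ℝ) * ∑ j, x j k * x j l := by
  simp [sampleCov, Matrix.mul_apply]

lemma sampleCov_mul_apply {n p : ℕ} (x : Matrix (Fin n) (Fin p) ℝ) (T : Matrix (Fin p) (Fin p) ℝ)
    (k l : Fin p) :
    (sampleCov x * T) k l = 1 / (n : ℝ) * ∑ j, x j k * (x * T) j l := by
  rw [sampleCov, Matrix.smul_mul, Matrix.mul_assoc]
  simp only [Matrix.smul_apply, smul_eq_mul]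
  rw [Matrix.mul_apply]; rfl

/-- The sample covariance of `x` is entrywise `τ`-close to `S`, and `S⁻¹` is an entrywise
`τ`-approximate right inverse of it. -/
def IsGoodDesign {n p : ℕ} (τ : ℝ) (S : Matrix (Fin p) (Fin p) ℝ)
    (x : Matrix (Fin n) (Fin p) ℝ) : Prop :=
  ∀ k l, |sampleCov x k l - S k l| ≤ τ ∧
    |(sampleCov x * S⁻¹) k l - (1 : Matrix (Fin p) (Fin p) ℝ) k l| ≤ τ

lemma measurableSet_isGoodDesign {n p : ℕ} (τ : ℝ) (S : Matrix (Fin p) (Fin p) ℝ) :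
    MeasurableSet {x : Matrix (Fin n) (Fin p) ℝ | IsGoodDesign τ S x} := by
  have hm : ∀ (j : Fin n) (k : Fin p), Measurable fun x : Matrix (Fin n) (Fin p) ℝ => x j k :=
    fun j k => measurable_matrix_apply measurable_id j k
  have h1 : ∀ k l, Measurable fun x : Matrix (Fin n) (Fin p) ℝ => sampleCov x k l := fun k l => by
    simp only [sampleCov_apply]
    exact measurable_const.mul (Finset.measurable_sum _ fun j _ => (hm j k).mul (hm j l))
  have h2 : ∀ k l, Measurable fun x : Matrix (Fin n) (Fin p) ℝ => (sampleCov x * S⁻¹) k l :=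
    fun k l => by
      simp only [Matrix.mul_apply]
      exact Finset.measurable_sum _ fun m _ => (h1 k m).mul_const _
  have : {x : Matrix (Fin n) (Fin p) ℝ | IsGoodDesign τ S x} = ⋂ k, ⋂ l,
      ({x | |sampleCov x k l - S k l| ≤ τ} ∩
        {x | |(sampleCov x * S⁻¹) k l - (1 : Matrix (Fin p) (Fin p) ℝ) k l| ≤ τ}) := by
    ext x; simp [IsGoodDesign]
  rw [this]
  exact MeasurableSet.iInter fun k => MeasurableSet.iInter fun l =>
    (measurableSet_le ((h1 k l).sub_const _).abs measurable_const).inter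
      (measurableSet_le ((h2 k l).sub_const _).abs measurable_const)

lemma le_abs_sum_sub_of_lt {n : ℕ} {τ e : ℝ} (hn : 0 < n) {f : Fin n → ℝ}
    (h : τ < |1 / (n : ℝ) * ∑ j, f j - e|) : n * τ ≤ |∑ j, (f j - e)| := by
  have hn' : (0 : ℝ) < n := by exact_mod_cast hn
  have h1 : ∑ j, (f j - e) = n * (1 / (n : ℝ) * ∑ j, f j - e) := by
    rw [Finset.sum_sub_distrib]; simp; field_simp
  rw [h1, abs_mul, abs_of_pos hn']
  gcongr

/-- With high probability the sample covariance is entrywise close to the population covariance,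
and the population precision matrix satisfies the debiasing constraints. -/
lemma IsSubGaussianDesign.measure_not_isGoodDesign_le [IsProbabilityMeasure P] {n p : ℕ}
    {X : Ω → Matrix (Fin n) (Fin p) ℝ} {S : Matrix (Fin p) (Fin p) ℝ} {Cmin Cmax κ : ℝ}
    (hD : IsSubGaussianDesign P X S Cmin Cmax κ) (hC : 0 < Cmin) (hκ : 0 ≤ κ) (hn : 0 < n)
    {s τ : ℝ} (hs : 0 < s) (hsκ : 4 * Real.exp 1 * s * (κ ^ 2 * (1 + 1 / Cmin)) ≤ 1)
    (hτ : 0 < τ) (hsτ : s * τ ≤ 44) :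
    P.real {ω | ¬ IsGoodDesign τ S (X ω)} ≤
      p ^ 2 * (4 * Real.exp (-(n * τ ^ 2 * s ^ 2 / 176))) := by
  -- A common length bound for columns of √S (squared length S_kk ≤ 1) and of S^{-1/2} (squared
  -- length (S⁻¹)_kk ≤ 1/Cmin).
  set b := √(1 + 1 / Cmin) with hb
  have hC' : 0 < 1 / Cmin := by positivity
  have hb0 : 0 ≤ b := Real.sqrt_nonneg _
  have hb2 : b ^ 2 = 1 + 1 / Cmin := Real.sq_sqrt (by positivity)
  have hsκ' : 4 * Real.exp 1 * s * (κ * b) ^ 2 ≤ 1 := by rwa [mul_pow, hb2]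
  set R : Fin p → Fin p → ℝ := fun k m => CFC.sqrt S m k with hR
  set Q : Fin p → Fin p → ℝ := fun k m => invSqrt S m k with hQ
  have hRb : ∀ k, ∑ m, R k m ^ 2 ≤ b ^ 2 := fun k => by
    rw [hb2, hR, sum_sq_sqrt hD.posSemidef]; linarith [hD.diag_le_one k]
  have hQb : ∀ k, ∑ m, Q k m ^ 2 ≤ b ^ 2 := fun k => by
    rw [hb2, hQ, sum_sq_invSqrt hD.posSemidef]
    linarith [inv_diag_le hD.posSemidef hC hD.le_eigenvalues k]
  have hX : ∀ ω j k, X ω j k = (X ω * invSqrt S) j ⬝ᵥ R k := hD.apply_eq_dotProduct hC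
  have hXS : ∀ ω j k, (X ω * S⁻¹) j k = (X ω * invSqrt S) j ⬝ᵥ Q k :=
    hD.mul_inv_apply_eq_dotProduct
  have hint : ∀ j k l, Integrable (fun ω => X ω j k * X ω j l) P := fun j k l => by
    refine integrable_of_lintegral_exp_abs_le
      ((measurable_matrix_apply hD.measurable j k).mul
        (measurable_matrix_apply hD.measurable j l)) hs ?_
    simp only [hX]
    exact hD.lintegral_exp_le hκ hb0 (hRb k) (hRb l) hs.le hsκ' j
  have he1 : ∀ k l j, ∫ ω, ((X ω * invSqrt S) j ⬝ᵥ R k) * ((X ω * invSqrt S) j ⬝ᵥ R l) ∂P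
      = S k l := fun k l j => by
    simp only [← hX]; exact hD.covariance j k l
  -- The product is X_jk (XS⁻¹)_jl, whose mean is (S S⁻¹)_kl.
  have he2 : ∀ k l j, ∫ ω, ((X ω * invSqrt S) j ⬝ᵥ R k) * ((X ω * invSqrt S) j ⬝ᵥ Q l) ∂P
      = (1 : Matrix (Fin p) (Fin p) ℝ) k l := fun k l j => by
    simp only [← hX, ← hXS, Matrix.mul_apply, Finset.mul_sum, ← mul_assoc]
    rw [integral_finsetSum _ fun m _ => (hint j k m).mul_const _]
    simp only [integral_mul_const, hD.covariance]
    rw [← Matrix.mul_apply, Matrix.mul_nonsing_inv _ (hD.posDef hC).det_pos.ne'.isUnit]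
  have h1 := fun k l => hD.measure_le_abs_sum hκ hb0 (hRb k) (hRb l) hs hsκ' hτ hsτ (he1 k l)
  have h2 := fun k l => hD.measure_le_abs_sum hκ hb0 (hRb k) (hQb l) hs hsκ' hτ hsτ (he2 k l)
  set δ := Real.exp (-(n * τ ^ 2 * s ^ 2 / 176))
  set E : Fin p × Fin p → Set Ω := fun q =>
    {ω | n * τ ≤ |∑ j, (((X ω * invSqrt S) j ⬝ᵥ R q.1) * ((X ω * invSqrt S) j ⬝ᵥ R q.2)
      - S q.1 q.2)|} ∪
    {ω | n * τ ≤ |∑ j, (((X ω * invSqrt S) j ⬝ᵥ R q.1) * ((X ω * invSqrt S) j ⬝ᵥ Q q.2)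
      - (1 : Matrix (Fin p) (Fin p) ℝ) q.1 q.2)|} with hE
  have hEle : ∀ q, P.real (E q) ≤ 4 * δ := fun q =>
    (measureReal_union_le _ _).trans (by linarith [h1 q.1 q.2, h2 q.1 q.2])
  have hsub : {ω | ¬ IsGoodDesign τ S (X ω)} ⊆ ⋃ q, E q := by
    intro ω hω
    simp only [Set.mem_ofPred_eq, IsGoodDesign, not_forall] at hω
    obtain ⟨k, l, hkl⟩ := hω
    rw [not_and_or, not_le, not_le, sampleCov_apply, sampleCov_mul_apply] at hkl
    refine Set.mem_iUnion.2 ⟨(k, l), ?_⟩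
    rcases hkl with h | h
    · left
      have := le_abs_sum_sub_of_lt hn h
      rw [Set.mem_ofPred_eq]
      simpa only [hX] using this
    · right
      have := le_abs_sum_sub_of_lt hn h
      rw [Set.mem_ofPred_eq]
      simpa only [hX, hXS] using this
  calc _ ≤ P.real (⋃ q, E q) := measureReal_mono hsub
    _ ≤ ∑ q, P.real (E q) := measureReal_iUnion_fintype_le _
    _ ≤ ∑ q : Fin p × Fin p, 4 * δ := Finset.sum_le_sum fun q _ => hEle q
    _ = _ := by
        simp only [Finset.sum_const, Finset.card_univ, Fintype.card_prod, Fintype.card_fin,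
          nsmul_eq_mul, Nat.cast_mul]
        ring

end Design

/-! ### Gaussian noise conditional on the design -/

section GaussianNoise

lemma map_dotProduct_pi_gaussianReal {n : ℕ} (v : NNReal) (u : Fin n → ℝ) :
    (Measure.pi fun _ : Fin n => gaussianReal 0 v).map (fun w => u ⬝ᵥ w) =
      gaussianReal 0 ((∑ j, u j ^ 2).toNNReal * v) := by
  set ν := Measure.pi fun _ : Fin n => gaussianReal 0 v
  set f : Fin n → (Fin n → ℝ) → ℝ := fun j w => u j * w j with hf
  have hfm : ∀ j, Measurable (f j) := fun j => by simp only [hf]; fun_prop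
  have hind : iIndepFun f ν :=
    iIndepFun_pi (X := fun j (x : ℝ) => u j * x) (fun j => by fun_prop)
  have hlaw : ∀ j, ν.map (f j) = gaussianReal 0 ((u j ^ 2).toNNReal * v) := fun j => by
    have h1 : f j = (fun x => u j * x) ∘ Function.eval j := rfl
    have hev : Measurable (Function.eval j : (Fin n → ℝ) → ℝ) := measurable_pi_apply j
    rw [h1, ← Measure.map_map (by fun_prop) hev,
      (measurePreserving_eval (fun _ : Fin n => gaussianReal 0 v) j).map_eq,
      gaussianReal_map_const_mul, mul_zero]
    congr 2
    rw [Real.toNNReal_of_nonneg (sq_nonneg _)]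
  have hsum : ∀ s : Finset (Fin n),
      ν.map (∑ j ∈ s, f j) = gaussianReal 0 ((∑ j ∈ s, u j ^ 2).toNNReal * v) := by
    intro s
    induction s using Finset.induction_on with
    | empty =>
      simp only [Finset.sum_empty, Real.toNNReal_zero, zero_mul, gaussianReal_zero_var]
      exact (Measure.map_const ν (0 : ℝ)).trans (by simp)
    | insert j s hj ih =>
      rw [Finset.sum_insert hj, Finset.sum_insert hj, add_comm (f j), add_comm (u j ^ 2),
        gaussianReal_add_gaussianReal_of_indepFun
          (hind.indepFun_finsetSum_of_notMem hfm hj) ih (hlaw j), zero_add, ← add_mul,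
        Real.toNNReal_add (Finset.sum_nonneg fun _ _ => sq_nonneg _) (sq_nonneg _)]
  have := hsum Finset.univ
  convert this using 2
  funext w
  simp [dotProduct, hf]

/-- The proxy v is separate from the variance c, so that one bound serves all design columns,
including zero ones. -/
lemma gaussianReal_le_abs_le {c v : NNReal} (hcv : c ≤ v) {t : ℝ} (ht : 0 ≤ t) :
    (gaussianReal 0 c).real {x | t ≤ |x|} ≤ 2 * Real.exp (-t ^ 2 / (2 * v)) := by
  have h : HasSubgaussianMGF id v (gaussianReal 0 c) := by
    refine ⟨fun t => integrable_exp_mul_gaussianReal t, fun t => ?_⟩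
    rw [mgf_id_gaussianReal]
    simp only [zero_mul, zero_add, Real.exp_le_exp]
    have : (c : ℝ) ≤ v := by exact_mod_cast hcv
    gcongr
  calc _ ≤ (gaussianReal 0 c).real ({x | t ≤ id x} ∪ {x | t ≤ (-id) x}) := by
        refine measureReal_mono fun x hx => ?_
        rw [Set.mem_ofPred_eq] at hx
        rcases le_abs.1 hx with h | h
        · left; exact h
        · right; exact h
    _ ≤ _ := measureReal_union_le _ _
    _ ≤ _ := by linarith [h.measure_ge_le ht, h.neg.measure_ge_le ht]

lemma pi_gaussianReal_le_abs_dotProduct_le {n : ℕ} {σ B t : ℝ} {u : Fin n → ℝ}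
    (hu : ∑ j, u j ^ 2 ≤ B) (ht : 0 ≤ t) :
    (Measure.pi fun _ : Fin n => gaussianReal 0 (σ ^ 2).toNNReal).real {w | t ≤ |u ⬝ᵥ w|} ≤
      2 * Real.exp (-t ^ 2 / (2 * (B * σ ^ 2))) := by
  have hm : Measurable fun w : Fin n → ℝ => u ⬝ᵥ w := by simp only [dotProduct]; fun_prop
  have hB : 0 ≤ B := (Finset.sum_nonneg fun _ _ => sq_nonneg _).trans hu
  have h1 := gaussianReal_le_abs_le (c := (∑ j, u j ^ 2).toNNReal * (σ ^ 2).toNNReal)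
    (v := B.toNNReal * (σ ^ 2).toNNReal)
    (mul_le_mul_left (Real.toNNReal_le_toNNReal hu) _) ht
  have hms : MeasurableSet {x : ℝ | t ≤ |x|} := measurableSet_le measurable_const (by fun_prop)
  rw [← map_dotProduct_pi_gaussianReal, map_measureReal_apply hm hms] at h1
  rw [NNReal.coe_mul, Real.coe_toNNReal _ hB, Real.coe_toNNReal _ (sq_nonneg _)] at h1
  exact h1

lemma pi_gaussianReal_normalized_le {n : ℕ} {σ : ℝ} (hσ : 0 < σ) {u : Fin n → ℝ}
    (hu : 0 < ∑ j, u j ^ 2) (t : ℝ) :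
    (Measure.pi fun _ : Fin n => gaussianReal 0 (σ ^ 2).toNNReal)
      {w | (u ⬝ᵥ w) / (σ * √(∑ j, u j ^ 2)) ≤ t} = gaussianReal 0 1 (Set.Iic t) := by
  have hm : Measurable fun w : Fin n → ℝ => u ⬝ᵥ w := by simp only [dotProduct]; fun_prop
  set r := σ * √(∑ j, u j ^ 2) with hr
  have hr0 : 0 < r := mul_pos hσ (Real.sqrt_pos.2 hu)
  have h1 : (gaussianReal 0 ((∑ j, u j ^ 2).toNNReal * (σ ^ 2).toNNReal)).map (· / r) =
      gaussianReal 0 1 := by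
    rw [gaussianReal_map_div_const, zero_div]
    congr 1
    apply NNReal.eq
    have hr2 : r ^ 2 = (∑ j, u j ^ 2) * σ ^ 2 := by
      rw [hr, mul_pow, Real.sq_sqrt hu.le, mul_comm]
    simp only [NNReal.coe_div, NNReal.coe_mul, NNReal.coe_mk, Real.coe_toNNReal _ hu.le,
      Real.coe_toNNReal _ (sq_nonneg σ), NNReal.coe_one, hr2]
    field_simp
  rw [← h1, ← map_dotProduct_pi_gaussianReal, Measure.map_map (by fun_prop) hm,
    Measure.map_apply (Measurable.comp (g := (· / r)) (by fun_prop) hm) measurableSet_Iic]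
  rfl

variable {Ω : Type*} [MeasurableSpace Ω] {P : Measure Ω} [IsProbabilityMeasure P]
  {α β : Type*} [MeasurableSpace α] [MeasurableSpace β]

lemma measure_mem_and_mem_eq_setLIntegral {X : Ω → α} {W : Ω → β} {ν : Measure β}
    [IsProbabilityMeasure ν]
    (hX : Measurable X) (hW : HasLaw W ν P) (hXW : IndepFun X W P) {G : Set α}
    (hG : MeasurableSet G) {D : Set (α × β)} (hD : MeasurableSet D) :
    P {ω | X ω ∈ G ∧ (X ω, W ω) ∈ D} = ∫⁻ x in G, ν (Prod.mk x ⁻¹' D) ∂(P.map X) := by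
  have h1 := (indepFun_iff_map_prod_eq_prod_map_map hX.aemeasurable hW.aemeasurable).1 hXW
  have hGm : MeasurableSet (Prod.fst ⁻¹' G : Set (α × β)) := measurable_fst hG
  have : P {ω | X ω ∈ G ∧ (X ω, W ω) ∈ D} =
      (P.map fun ω => (X ω, W ω)) (Prod.fst ⁻¹' G ∩ D) := by
    rw [Measure.map_apply_of_aemeasurable (hX.aemeasurable.prodMk hW.aemeasurable)
      (hGm.inter hD)]
    rfl
  have : IsProbabilityMeasure (P.map X) := Measure.isProbabilityMeasure_map hX.aemeasurable
  rw [‹P _ = _›, h1, hW.map_eq, Measure.prod_apply (hGm.inter hD), ← lintegral_indicator hG]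
  refine lintegral_congr fun x => ?_
  by_cases hx : x ∈ G
  · rw [Set.indicator_of_mem hx]
    congr 1
    ext w; simp [hx]
  · rw [Set.indicator_of_notMem hx]
    have : Prod.mk x ⁻¹' (Prod.fst ⁻¹' G ∩ D) = ∅ := by ext w; simp [hx]
    rw [this, measure_empty]

lemma measureReal_mem_and_mem_le {X : Ω → α} {W : Ω → β} {ν : Measure β} [IsProbabilityMeasure ν]
    (hX : Measurable X) (hW : HasLaw W ν P) (hXW : IndepFun X W P) {G : Set α}
    (hG : MeasurableSet G) {D : Set (α × β)} (hD : MeasurableSet D) {δ : ℝ} (hδ : 0 ≤ δ)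
    (h : ∀ x ∈ G, ν.real (Prod.mk x ⁻¹' D) ≤ δ) :
    P.real {ω | X ω ∈ G ∧ (X ω, W ω) ∈ D} ≤ δ := by
  have : IsProbabilityMeasure (P.map X) := Measure.isProbabilityMeasure_map hX.aemeasurable
  rw [measureReal_def, measure_mem_and_mem_eq_setLIntegral hX hW hXW hG hD]
  refine ENNReal.toReal_le_of_le_ofReal hδ ?_
  calc _ ≤ ∫⁻ x in G, ENNReal.ofReal δ ∂(P.map X) := by
        refine setLIntegral_mono measurable_const fun x hx => ?_
        rw [← ofReal_measureReal]
        exact ENNReal.ofReal_le_ofReal (h x hx)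
    _ = ENNReal.ofReal δ * (P.map X) G := setLIntegral_const _ _
    _ ≤ ENNReal.ofReal δ * 1 := by gcongr; exact prob_le_one
    _ = _ := mul_one _

/-- By Fubini for the product law of (X, W): each slice x ∈ G has the same probability Φ(t), so the
integral over G factors. -/
lemma measureReal_normalized_noise_le {n : ℕ} {X : Ω → α} {W : Ω → Fin n → ℝ} {σ : ℝ}
    (hσ : 0 < σ) (hX : Measurable X)
    (hW : HasLaw W (Measure.pi fun _ => gaussianReal 0 (σ ^ 2).toNNReal) P)
    (hXW : IndepFun X W P) {G : Set α} (hG : MeasurableSet G) {u : α → Fin n → ℝ}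
    (hu : Measurable u) (hpos : ∀ x ∈ G, 0 < ∑ j, u x j ^ 2) (t : ℝ) :
    P.real {ω | X ω ∈ G ∧ (u (X ω) ⬝ᵥ W ω) / (σ * √(∑ j, u (X ω) j ^ 2)) ≤ t} =
      cdf (gaussianReal 0 1) t * P.real {ω | X ω ∈ G} := by
  have huj : ∀ j, Measurable fun x => u x j := fun j => (measurable_pi_apply j).comp hu
  have hD : MeasurableSet {q : α × (Fin n → ℝ) |
      (u q.1 ⬝ᵥ q.2) / (σ * √(∑ j, u q.1 j ^ 2)) ≤ t} := by
    refine measurableSet_le (Measurable.div ?_ (measurable_const.mul (Measurable.sqrt ?_)))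
      measurable_const
    · exact Finset.measurable_sum _ fun j _ => ((huj j).comp measurable_fst).mul
        ((measurable_pi_apply j).comp measurable_snd)
    · exact Finset.measurable_sum _ fun j _ => ((huj j).comp measurable_fst).pow_const 2
  have h := measure_mem_and_mem_eq_setLIntegral hX hW hXW hG hD
  have h2 : ∫⁻ x in G, (Measure.pi fun _ => gaussianReal 0 (σ ^ 2).toNNReal) (Prod.mk x ⁻¹'
      {q : α × (Fin n → ℝ) | (u q.1 ⬝ᵥ q.2) / (σ * √(∑ j, u q.1 j ^ 2)) ≤ t}) ∂(P.map X) =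
      gaussianReal 0 1 (Set.Iic t) * P {ω | X ω ∈ G} := by
    calc _ = ∫⁻ x in G, gaussianReal 0 1 (Set.Iic t) ∂(P.map X) :=
          setLIntegral_congr_fun hG fun x hx => pi_gaussianReal_normalized_le hσ (hpos x hx) t
      _ = gaussianReal 0 1 (Set.Iic t) * P {ω | X ω ∈ G} := by
          rw [setLIntegral_const, Measure.map_apply hX hG]; rfl
  rw [cdf_eq_real, measureReal_def, measureReal_def, measureReal_def, ← ENNReal.toReal_mul,
    ← h2, ← h]
  rfl

lemma measureReal_le_abs_transpose_mulVec_le {n p : ℕ} {X : Ω → Matrix (Fin n) (Fin p) ℝ}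
    {W : Ω → Fin n → ℝ} {σ B t : ℝ} (hX : Measurable X)
    (hW : HasLaw W (Measure.pi fun _ => gaussianReal 0 (σ ^ 2).toNNReal) P)
    (hXW : IndepFun X W P) {G : Set (Matrix (Fin n) (Fin p) ℝ)} (hG : MeasurableSet G)
    (hB : ∀ x ∈ G, ∀ k, ∑ j, x j k ^ 2 ≤ B) (ht : 0 ≤ t) :
    P.real {ω | X ω ∈ G ∧ ∃ k, t ≤ |((X ω)ᵀ *ᵥ W ω) k|} ≤
      p * (2 * Real.exp (-t ^ 2 / (2 * (B * σ ^ 2)))) := by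
  have hD : ∀ k : Fin p, MeasurableSet {q : Matrix (Fin n) (Fin p) ℝ × (Fin n → ℝ) |
      t ≤ |(q.1ᵀ *ᵥ q.2) k|} := fun k => by
    refine measurableSet_le measurable_const (Measurable.abs ?_)
    exact Finset.measurable_sum Finset.univ fun j _ =>
      (measurable_matrix_apply (X := Prod.fst) measurable_fst j k).mul
        ((measurable_pi_apply j).comp measurable_snd)
  have hk : ∀ k : Fin p, P.real {ω | X ω ∈ G ∧ (X ω, W ω) ∈
      {q : Matrix (Fin n) (Fin p) ℝ × (Fin n → ℝ) | t ≤ |(q.1ᵀ *ᵥ q.2) k|}} ≤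
      2 * Real.exp (-t ^ 2 / (2 * (B * σ ^ 2))) := fun k =>
    measureReal_mem_and_mem_le hX hW hXW hG (hD k) (by positivity) fun x hx =>
      pi_gaussianReal_le_abs_dotProduct_le (hB x hx k) ht
  calc _ ≤ P.real (⋃ k : Fin p, {ω | X ω ∈ G ∧ (X ω, W ω) ∈
      {q : Matrix (Fin n) (Fin p) ℝ × (Fin n → ℝ) | t ≤ |(q.1ᵀ *ᵥ q.2) k|}}) := by
        refine measureReal_mono fun ω hω => ?_
        obtain ⟨h1, k, h2⟩ := hω
        exact Set.mem_iUnion.2 ⟨k, h1, h2⟩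
    _ ≤ _ := measureReal_iUnion_fintype_le _
    _ ≤ _ := Finset.sum_le_sum fun k _ => hk k
    _ = _ := by simp

end GaussianNoise

/-! ### Deterministic analysis of the LASSO and of debiasing -/

section Deterministic

variable {n p : ℕ}

lemma dotProduct_sampleCov_mulVec (x : Matrix (Fin n) (Fin p) ℝ) (m v : Fin p → ℝ) :
    v ⬝ᵥ (sampleCov x *ᵥ m) = 1 / (n : ℝ) * ((x *ᵥ m) ⬝ᵥ (x *ᵥ v)) := by
  rw [sampleCov, Matrix.smul_mulVec, dotProduct_smul, smul_eq_mul, ← Matrix.mulVec_mulVec,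
    Matrix.dotProduct_mulVec, Matrix.vecMul_transpose, dotProduct_comm]

lemma dotProduct_sampleCov_mulVec_self (x : Matrix (Fin n) (Fin p) ℝ) (m : Fin p → ℝ) :
    m ⬝ᵥ (sampleCov x *ᵥ m) = 1 / (n : ℝ) * ∑ j, (x *ᵥ m) j ^ 2 := by
  rw [dotProduct_sampleCov_mulVec]; simp [dotProduct, sq]

lemma dotProduct_le_mul_sum_abs {u v : Fin p → ℝ} {c : ℝ} (h : ∀ k, |u k| ≤ c) :
    |u ⬝ᵥ v| ≤ c * ∑ k, |v k| := by
  rw [dotProduct, Finset.mul_sum]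
  refine (Finset.abs_sum_le_sum_abs _ _).trans (Finset.sum_le_sum fun k _ => ?_)
  rw [abs_mul]
  exact mul_le_mul_of_nonneg_right (h k) (abs_nonneg _)

lemma quadratic_form_sub_le {A B : Matrix (Fin p) (Fin p) ℝ} {δ : ℝ}
    (h : ∀ k l, |A k l - B k l| ≤ δ) (v : Fin p → ℝ) :
    v ⬝ᵥ (B *ᵥ v) ≤ v ⬝ᵥ (A *ᵥ v) + δ * (∑ k, |v k|) ^ 2 := by
  have h1 : ∀ k, |((A - B) *ᵥ v) k| ≤ δ * ∑ l, |v l| := fun k =>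
    dotProduct_le_mul_sum_abs (u := fun l => (A - B) k l) (h k)
  have h2 := dotProduct_le_mul_sum_abs (v := v) h1
  rw [dotProduct_comm, Matrix.sub_mulVec, dotProduct_sub] at h2
  nlinarith [neg_abs_le (v ⬝ᵥ (A *ᵥ v) - v ⬝ᵥ (B *ᵥ v))]

/-- The `ℓ₁` error bound of the LASSO under entrywise closeness of the sample covariance to a
well-conditioned matrix. -/
lemma IsLassoEstimate.sum_abs_sub_le {lam Cmin δ : ℝ} {s₀ : ℕ} {θ θ₀ : Fin p → ℝ}
    {w : Fin n → ℝ} {x : Matrix (Fin n) (Fin p) ℝ} {S : Matrix (Fin p) (Fin p) ℝ}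
    (hθ : IsLassoEstimate lam (x *ᵥ θ₀ + w) x θ) (hn : 0 < n) (hlam : 0 < lam) (hC : 0 < Cmin)
    (hθ₀ : hammingNorm θ₀ ≤ s₀) (hw : ∀ k, |(xᵀ *ᵥ w) k| ≤ n * lam / 2)
    (hS : ∀ v : Fin p → ℝ, Cmin * ∑ k, v k ^ 2 ≤ v ⬝ᵥ (S *ᵥ v))
    (hδ0 : 0 ≤ δ) (hδ : ∀ k l, |sampleCov x k l - S k l| ≤ δ) (hs : 32 * s₀ * δ ≤ Cmin) :
    ∑ k, |θ k - θ₀ k| ≤ 24 * s₀ * lam / Cmin := by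
  have hn' : (0 : ℝ) < n := by exact_mod_cast hn
  set v : Fin p → ℝ := θ - θ₀ with hv
  set q := v ⬝ᵥ (sampleCov x *ᵥ v) with hq
  set T : Finset (Fin p) := Finset.univ.filter fun k => θ₀ k ≠ 0 with hT
  set A := ∑ k ∈ T, |v k| with hA
  set B := ∑ k ∈ Tᶜ, |v k| with hB
  have hA0 : 0 ≤ A := Finset.sum_nonneg fun _ _ => abs_nonneg _
  have hB0 : 0 ≤ B := Finset.sum_nonneg fun _ _ => abs_nonneg _
  have hAB : ∑ k, |v k| = A + B := (Finset.sum_add_sum_compl T _).symm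
  have hqs : q = 1 / (n : ℝ) * ∑ j, (x *ᵥ v) j ^ 2 := dotProduct_sampleCov_mulVec_self x v
  have hq0 : 0 ≤ q := by
    rw [hqs]; exact mul_nonneg (by positivity) (Finset.sum_nonneg fun _ _ => sq_nonneg _)
  have hcross : ∑ j, w j * (x *ᵥ v) j ≤ n * lam / 2 * (A + B) := by
    have h1 : ∑ j, w j * (x *ᵥ v) j = (xᵀ *ᵥ w) ⬝ᵥ v := by
      change w ⬝ᵥ (x *ᵥ v) = _
      rw [Matrix.dotProduct_mulVec, Matrix.mulVec_transpose]
    rw [h1, ← hAB]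
    exact (le_abs_self _).trans (dotProduct_le_mul_sum_abs hw)
  have hl1 : B - A ≤ ∑ k, |θ k| - ∑ k, |θ₀ k| := by
    rw [← Finset.sum_sub_distrib, ← Finset.sum_add_sum_compl T]
    have h1 : -A ≤ ∑ k ∈ T, (|θ k| - |θ₀ k|) := by
      rw [hA, ← Finset.sum_neg_distrib]
      refine Finset.sum_le_sum fun k _ => ?_
      have := abs_sub_abs_le_abs_sub (θ₀ k) (θ k)
      rw [abs_sub_comm] at this
      simp only [hv, Pi.sub_apply]
      linarith
    have h2 : B = ∑ k ∈ Tᶜ, (|θ k| - |θ₀ k|) := by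
      refine Finset.sum_congr rfl fun k hk => ?_
      have : θ₀ k = 0 := by simpa [hT] using hk
      simp [hv, this]
    linarith
  -- The basic inequality: compare the objective at θ and θ₀. The noise correlation absorbs only
  -- half of the penalty, leaving the cone condition B ≤ 3A.
  have hbasic : q + lam * B ≤ 3 * lam * A := by
    have h1 := hθ θ₀
    have h2 : ∀ j, (x *ᵥ θ₀ + w) j - (x *ᵥ θ) j = w j - (x *ᵥ v) j := fun j => by
      simp only [hv, Matrix.mulVec_sub, Pi.add_apply, Pi.sub_apply]; ring
    have h3 : ∀ j, (x *ᵥ θ₀ + w) j - (x *ᵥ θ₀) j = w j := fun j => by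
      simp only [Pi.add_apply]; ring
    simp only [lassoObjective, h2, h3] at h1
    have h4 : ∑ j, (w j - (x *ᵥ v) j) ^ 2 =
        ∑ j, w j ^ 2 - 2 * ∑ j, w j * (x *ᵥ v) j + n * q := by
      rw [hqs, ← mul_assoc, mul_one_div_cancel hn'.ne', one_mul, Finset.mul_sum,
        ← Finset.sum_sub_distrib, ← Finset.sum_add_distrib]
      exact Finset.sum_congr rfl fun j _ => by ring
    rw [h4] at h1
    have h5 : 1 / (2 * (n : ℝ)) * (∑ j, w j ^ 2 - 2 * ∑ j, w j * (x *ᵥ v) j + n * q) =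
        1 / (2 * (n : ℝ)) * ∑ j, w j ^ 2 - 1 / (n : ℝ) * ∑ j, w j * (x *ᵥ v) j + q / 2 := by
      field_simp
    rw [h5] at h1
    have h6 : 1 / (n : ℝ) * ∑ j, w j * (x *ᵥ v) j ≤ lam / 2 * (A + B) := by
      calc _ ≤ 1 / (n : ℝ) * (n * lam / 2 * (A + B)) := by gcongr
        _ = _ := by field_simp
    have h7 := mul_le_mul_of_nonneg_left hl1 hlam.le
    linarith
  have hBA : B ≤ 3 * A := by
    have : lam * B ≤ lam * (3 * A) := by linarith
    exact le_of_mul_le_mul_left this hlam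
  set N := ∑ k, v k ^ 2 with hN
  have hN0 : 0 ≤ N := Finset.sum_nonneg fun _ _ => sq_nonneg _
  have hAN : A ^ 2 ≤ s₀ * N := by
    calc A ^ 2 ≤ T.card * ∑ k ∈ T, |v k| ^ 2 := sq_sum_le_card_mul_sum_sq
      _ ≤ s₀ * N := by
        have h1 : (T.card : ℝ) ≤ s₀ := by exact_mod_cast hθ₀
        have h2 : ∑ k ∈ T, |v k| ^ 2 ≤ N := by
          simp only [sq_abs]
          exact Finset.sum_le_sum_of_subset_of_nonneg (Finset.subset_univ _)
            fun _ _ _ => sq_nonneg _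
        gcongr
  -- On the cone ‖v‖₁² ≤ 16A² ≤ 16s₀N, so replacing S by Σ̂ costs at most 16s₀δN ≤ (Cmin/2)N.
  have hlow : Cmin / 2 * N ≤ q := by
    have h1 := (hS v).trans (quadratic_form_sub_le hδ v)
    rw [hAB] at h1
    have h2 : (A + B) ^ 2 ≤ 16 * A ^ 2 := by nlinarith
    have h3 : δ * (A + B) ^ 2 ≤ Cmin / 2 * N := by
      calc δ * (A + B) ^ 2 ≤ δ * (16 * (s₀ * N)) := by gcongr; linarith
        _ = (32 * s₀ * δ) / 2 * N := by ring
        _ ≤ Cmin / 2 * N := by gcongr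
    linarith
  have hA6 : A ≤ 6 * s₀ * lam / Cmin := by
    rw [le_div_iff₀ hC]
    rcases hA0.eq_or_lt with h0 | hpos
    · rw [← h0, zero_mul]; positivity
    · have h1 : Cmin * N ≤ 6 * lam * A := by nlinarith [mul_nonneg hlam.le hB0]
      have h2 : A * (A * Cmin) ≤ A * (6 * s₀ * lam) := by
        calc A * (A * Cmin) = Cmin * A ^ 2 := by ring
          _ ≤ Cmin * (s₀ * N) := by gcongr
          _ = s₀ * (Cmin * N) := by ring
          _ ≤ s₀ * (6 * lam * A) := by gcongr
          _ = _ := by ring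
      exact le_of_mul_le_mul_left h2 hpos
  calc ∑ k, |θ k - θ₀ k| = A + B := hAB
    _ ≤ 4 * (6 * s₀ * lam / Cmin) := by linarith
    _ = _ := by ring

lemma IsGoodDesign.exists_isFeasible {τ μ : ℝ} {S : Matrix (Fin p) (Fin p) ℝ}
    {x : Matrix (Fin n) (Fin p) ℝ} (h : IsGoodDesign τ S x) (hτ : τ ≤ μ) (i : Fin p) :
    ∃ m, IsFeasible μ (sampleCov x) i m := by
  refine ⟨S⁻¹ *ᵥ Pi.single i 1, fun k => ?_⟩
  have h1 : (sampleCov x *ᵥ (S⁻¹ *ᵥ Pi.single i 1)) k = (sampleCov x * S⁻¹) k i := by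
    rw [Matrix.mulVec_mulVec]; simp
  have h2 : (Pi.single i 1 : Fin p → ℝ) k = (1 : Matrix (Fin p) (Fin p) ℝ) k i := by
    rw [Matrix.one_apply, Pi.single_apply]
  rw [h1, h2]
  exact (h k i).2.trans hτ

/-- The i-th constraint forces (Σ̂m)_i ≥ 1/2, and Cauchy–Schwarz for the form Σ̂ gives (Σ̂m)_i² ≤
Σ̂_ii · mᵀΣ̂m. -/
lemma IsFeasible.le_quadratic_form {μ : ℝ} {x : Matrix (Fin n) (Fin p) ℝ} {i : Fin p}
    {m : Fin p → ℝ} (h : IsFeasible μ (sampleCov x) i m) (hμ : μ ≤ 1 / 2)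
    (hi : sampleCov x i i ≤ 2) : 1 / 8 ≤ m ⬝ᵥ (sampleCov x *ᵥ m) := by
  have h1 := h i
  rw [Pi.single_eq_same] at h1
  have h2 : 1 / 2 ≤ (sampleCov x *ᵥ m) i := by linarith [neg_abs_le ((sampleCov x *ᵥ m) i - 1)]
  have h3 : (sampleCov x *ᵥ m) i = 1 / (n : ℝ) * ∑ j, x j i * (x *ᵥ m) j := by
    have := dotProduct_sampleCov_mulVec x m (Pi.single i 1)
    rw [single_dotProduct, one_mul] at this
    rw [this, dotProduct_comm]
    simp [dotProduct]
  have h4 : (sampleCov x *ᵥ m) i ^ 2 ≤ sampleCov x i i * (m ⬝ᵥ (sampleCov x *ᵥ m)) := by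
    rw [h3, dotProduct_sampleCov_mulVec_self, sampleCov_apply]
    calc _ = (1 / (n : ℝ)) ^ 2 * (∑ j, x j i * (x *ᵥ m) j) ^ 2 := by ring
      _ ≤ (1 / (n : ℝ)) ^ 2 * ((∑ j, x j i ^ 2) * ∑ j, (x *ᵥ m) j ^ 2) := by
          gcongr; exact Finset.sum_mul_sq_le_sq_mul_sq _ _ _
      _ = _ := by simp only [sq]; ring
  have h5 : 0 ≤ m ⬝ᵥ (sampleCov x *ᵥ m) := by
    rw [dotProduct_sampleCov_mulVec_self]
    exact mul_nonneg (by positivity) (Finset.sum_nonneg fun _ _ => sq_nonneg _)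
  nlinarith

lemma mul_sampleCov_mul_transpose_apply (x : Matrix (Fin n) (Fin p) ℝ)
    (M : Matrix (Fin p) (Fin p) ℝ) (i : Fin p) :
    (M * sampleCov x * Mᵀ) i i = M i ⬝ᵥ (sampleCov x *ᵥ M i) := by
  rw [Matrix.dotProduct_mulVec]; rfl

lemma debiased_sub_apply (θ θ₀ : Fin p → ℝ) (w : Fin n → ℝ) (x : Matrix (Fin n) (Fin p) ℝ)
    (M : Matrix (Fin p) (Fin p) ℝ) (i : Fin p) :
    debiased (x *ᵥ θ₀ + w) x M θ i - θ₀ i = 1 / (n : ℝ) * ((x *ᵥ M i) ⬝ᵥ w) -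
      (sampleCov x *ᵥ M i - Pi.single i 1) ⬝ᵥ (θ - θ₀) := by
  have h1 : x *ᵥ θ₀ + w - x *ᵥ θ = w - x *ᵥ (θ - θ₀) := by
    rw [Matrix.mulVec_sub]; abel
  have h2 : (M *ᵥ (xᵀ *ᵥ (w - x *ᵥ (θ - θ₀)))) i =
      (x *ᵥ M i) ⬝ᵥ w - (x *ᵥ M i) ⬝ᵥ (x *ᵥ (θ - θ₀)) := by
    change M i ⬝ᵥ (xᵀ *ᵥ (w - x *ᵥ (θ - θ₀))) = _
    rw [Matrix.dotProduct_mulVec, Matrix.vecMul_transpose, dotProduct_sub]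
  have h3 : (sampleCov x *ᵥ M i) ⬝ᵥ (θ - θ₀) =
      1 / (n : ℝ) * ((x *ᵥ M i) ⬝ᵥ (x *ᵥ (θ - θ₀))) := by
    rw [dotProduct_comm, dotProduct_sampleCov_mulVec]
  rw [debiased, h1, sub_dotProduct, h3, single_dotProduct]
  simp only [Pi.add_apply, Pi.smul_apply, smul_eq_mul, h2, Pi.sub_apply]
  ring

/-- The studentized statistic lies, up to a small perturbation of the threshold, on the same side
of `t` as the normalized noise `⟨x m_i, w⟩ / (σ ‖x m_i‖₂)`. -/
lemma studentized_le_sandwich {μ σ s ε ℓ η t : ℝ} {θ θ₀ : Fin p → ℝ} {w : Fin n → ℝ}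
    {x : Matrix (Fin n) (Fin p) ℝ} {M : Matrix (Fin p) (Fin p) ℝ} {i : Fin p} (hn : 0 < n)
    (hσ : 0 < σ) (hfeas : IsFeasible μ (sampleCov x) i (M i)) (hμ0 : 0 ≤ μ) (hμ : μ ≤ 1 / 2)
    (hi : sampleCov x i i ≤ 2) (hℓ : ∑ k, |θ k - θ₀ k| ≤ ℓ) (hε : ε ≤ 1)
    (hs : |s / σ - 1| < ε) (hη : 3 * (√(n : ℝ) * (μ * ℓ)) / σ ≤ η) :
    (((x *ᵥ M i) ⬝ᵥ w) / (σ * √(∑ j, (x *ᵥ M i) j ^ 2)) ≤ t - (ε * |t| + η) →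
      studentized s x M (debiased (x *ᵥ θ₀ + w) x M θ) θ₀ i ≤ t) ∧
    (studentized s x M (debiased (x *ᵥ θ₀ + w) x M θ) θ₀ i ≤ t →
      ((x *ᵥ M i) ⬝ᵥ w) / (σ * √(∑ j, (x *ᵥ M i) j ^ 2)) ≤ t + (ε * |t| + η)) := by
  have hn' : (0 : ℝ) < n := by exact_mod_cast hn
  obtain ⟨hs1, hs2⟩ := abs_lt.1 hs
  have hsσ : 0 < s / σ := by linarith
  have hs0 : 0 < s := by
    have := mul_pos hsσ hσ
    rwa [div_mul_cancel₀ _ hσ.ne'] at this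
  have hV := hfeas.le_quadratic_form hμ hi
  set V := M i ⬝ᵥ (sampleCov x *ᵥ M i) with hVdef
  have hVsum : V = 1 / (n : ℝ) * ∑ j, (x *ᵥ M i) j ^ 2 := dotProduct_sampleCov_mulVec_self x _
  have hsum : √(∑ j, (x *ᵥ M i) j ^ 2) = √(n : ℝ) * √V := by
    rw [← Real.sqrt_mul hn'.le, hVsum, ← mul_assoc, mul_one_div_cancel hn'.ne', one_mul]
  -- 1/8 ≥ 1/9 yields the factor 3 in `hη`.
  have hV0 : 1 / 3 ≤ √V := Real.le_sqrt_of_sq_le (by linarith)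
  have hVpos : 0 < √V := by linarith
  have hnpos : 0 < √(n : ℝ) := Real.sqrt_pos.2 hn'
  set d := (sampleCov x *ᵥ M i - Pi.single i 1) ⬝ᵥ (θ - θ₀) with hd
  have hdle : |d| ≤ μ * ℓ :=
    (dotProduct_le_mul_sum_abs (u := sampleCov x *ᵥ M i - Pi.single i 1)
      (fun k => hfeas k)).trans
      (mul_le_mul_of_nonneg_left hℓ hμ0)
  set Z := ((x *ᵥ M i) ⬝ᵥ w) / (σ * √(∑ j, (x *ᵥ M i) j ^ 2)) with hZ
  set D := √(n : ℝ) * d / (σ * √V) with hD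
  have hDle : |D| ≤ η := by
    refine le_trans ?_ hη
    rw [hD, abs_div, abs_mul, abs_of_pos hnpos, abs_of_pos (mul_pos hσ hVpos),
      div_le_div_iff₀ (mul_pos hσ hVpos) hσ]
    have h1 : √(n : ℝ) * |d| ≤ √(n : ℝ) * (μ * ℓ) := by gcongr
    have h2 : 0 ≤ √(n : ℝ) * (μ * ℓ) := le_trans (by positivity) h1
    calc √(n : ℝ) * |d| * σ ≤ √(n : ℝ) * (μ * ℓ) * σ := by gcongr
      _ ≤ 3 * (√(n : ℝ) * (μ * ℓ)) * (σ * √V) := by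
          nlinarith [mul_nonneg (mul_nonneg h2 hσ.le) (sub_nonneg.2 hV0)]
  -- Hence the event is Z ≤ t + t(s/σ − 1) + D, a shift of t by at most ε|t| + η. The bound ε ≤ 1
  -- makes s/σ positive, so the inequality keeps its direction.
  have hT : studentized s x M (debiased (x *ᵥ θ₀ + w) x M θ) θ₀ i = (Z - D) / (s / σ) := by
    rw [studentized, debiased_sub_apply, mul_sampleCov_mul_transpose_apply, ← hVdef, ← hd, hZ,
      hsum, hD]
    have hsq : √(n : ℝ) ^ 2 = n := Real.sq_sqrt hn'.le
    field_simp
    rw [hsq]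
  rw [hT, div_le_iff₀ hsσ]
  have habs : |t * (s / σ - 1)| ≤ ε * |t| := by
    rw [abs_mul, mul_comm]; gcongr
  obtain ⟨h1, h2⟩ := abs_le.1 habs
  obtain ⟨h3, h4⟩ := abs_le.1 hDle
  constructor <;> intro h <;> linarith

end Deterministic

/-! ### Non-asymptotic normal approximation -/

section Inference

/-- A nondegenerate Gaussian has no atoms, so its distribution function has no jumps. -/
lemma continuous_cdf_gaussianReal : Continuous (cdf (gaussianReal 0 1)) := by
  have : NullSingletonClass (gaussianReal 0 1) := nullSingletonClass_gaussianReal one_ne_zero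
  refine continuous_iff_continuousAt.2 fun x => ?_
  rw [(monotone_cdf _).continuousAt_iff_leftLim_eq_rightLim, StieltjesFunction.rightLim_eq]
  have h := (cdf (gaussianReal 0 1)).measure_singleton x
  rw [measure_cdf, measure_singleton] at h
  have h1 := ENNReal.ofReal_eq_zero.1 h.symm
  have h2 := (monotone_cdf (gaussianReal 0 1)).leftLim_le (le_refl x)
  linarith

variable {Ω : Type*} [MeasurableSpace Ω] {P : Measure Ω} [IsProbabilityMeasure P]

/-- A non-asymptotic normal approximation for the studentized debiased LASSO. -/
lemma abs_measureReal_studentized_sub_cdf_le {n p s₀ : ℕ} {Cmin Cmax κ τ μ lam σ ε η r₁ r₂ r₃ : ℝ}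
    {X : Ω → Matrix (Fin n) (Fin p) ℝ} {S : Matrix (Fin p) (Fin p) ℝ} {W : Ω → Fin n → ℝ}
    {M : Matrix (Fin n) (Fin p) ℝ → Matrix (Fin p) (Fin p) ℝ} {θ₀ : Fin p → ℝ}
    {θ : Ω → Fin p → ℝ} {s : Ω → ℝ}
    (hD : IsSubGaussianDesign P X S Cmin Cmax κ) (hC : 0 < Cmin) (hn : 0 < n) (hσ : 0 < σ)
    (hW : HasLaw W (Measure.pi fun _ => gaussianReal 0 (σ ^ 2).toNNReal) P)
    (hXW : IndepFun X W P) (hMm : Measurable M)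
    (hM : ∀ x, IsDebiasingMatrix μ (sampleCov x) (M x))
    (hθ : ∀ ω, IsLassoEstimate lam (X ω *ᵥ θ₀ + W ω) (X ω) (θ ω)) (hθ₀ : hammingNorm θ₀ ≤ s₀)
    (hτ : 0 < τ) (hτμ : τ ≤ μ) (hμ : μ ≤ 1 / 2) (hlam : 0 < lam)
    (hs₀ : 32 * s₀ * τ ≤ Cmin) (hε0 : 0 ≤ ε)
    (hε : ε ≤ 1) (hη : 3 * (√(n : ℝ) * (μ * (24 * s₀ * lam / Cmin))) / σ ≤ η)
    (hr₁ : P.real {ω | ¬ IsGoodDesign τ S (X ω)} ≤ r₁)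
    (hr₂ : P.real {ω | X ω ∈ {x | IsGoodDesign τ S x} ∧
      ∃ k, n * lam / 2 ≤ |((X ω)ᵀ *ᵥ W ω) k|} ≤ r₂)
    (hr₃ : P.real {ω | ε ≤ |s ω / σ - 1|} ≤ r₃) (i : Fin p) (t : ℝ) :
    |P.real {ω | studentized (s ω) (X ω) (M (X ω))
        (debiased (X ω *ᵥ θ₀ + W ω) (X ω) (M (X ω)) (θ ω)) θ₀ i ≤ t} -
        cdf (gaussianReal 0 1) t| ≤
      cdf (gaussianReal 0 1) (t + (ε * |t| + η)) - cdf (gaussianReal 0 1) (t - (ε * |t| + η)) +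
        (r₁ + r₂ + r₃) := by
  set G : Set (Matrix (Fin n) (Fin p) ℝ) := {x | IsGoodDesign τ S x} with hGdef
  have hG : MeasurableSet G := measurableSet_isGoodDesign τ S
  set Φ := cdf (gaussianReal 0 1)
  set u : Matrix (Fin n) (Fin p) ℝ → Fin n → ℝ := fun x => x *ᵥ M x i with hu
  have hum : Measurable u := measurable_pi_lambda _ fun j =>
    Finset.measurable_sum Finset.univ fun k _ =>
      (measurable_matrix_apply measurable_id j k).mul (measurable_matrix_apply hMm i k)
  have hfeas : ∀ x ∈ G, IsFeasible μ (sampleCov x) i (M x i) := fun x hx =>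
    ((hM x).1 (fun l => hx.exists_isFeasible hτμ l) i).1
  have hdiag : ∀ x ∈ G, sampleCov x i i ≤ 2 := fun x hx => by
    have := (abs_le.1 (hx i i).1).2
    linarith [hD.diag_le_one i]
  have hpos : ∀ x ∈ G, 0 < ∑ j, u x j ^ 2 := fun x hx => by
    have h1 := (hfeas x hx).le_quadratic_form hμ (hdiag x hx)
    rw [dotProduct_sampleCov_mulVec_self] at h1
    by_contra! h2
    have : 1 / (n : ℝ) * ∑ j, u x j ^ 2 ≤ 0 := mul_nonpos_of_nonneg_of_nonpos (by positivity) h2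
    linarith
  set Z : Ω → ℝ := fun ω => (u (X ω) ⬝ᵥ W ω) / (σ * √(∑ j, u (X ω) j ^ 2)) with hZ
  have hZcdf : ∀ z, P.real {ω | X ω ∈ G ∧ Z ω ≤ z} = Φ z * P.real {ω | X ω ∈ G} := fun z =>
    measureReal_normalized_noise_le hσ hD.measurable hW hXW hG hum hpos z
  set T : Set Ω := {ω | studentized (s ω) (X ω) (M (X ω))
        (debiased (X ω *ᵥ θ₀ + W ω) (X ω) (M (X ω)) (θ ω)) θ₀ i ≤ t} with hT
  set E₁ : Set Ω := {ω | ¬ IsGoodDesign τ S (X ω)} with hE₁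
  set E₂ : Set Ω := {ω | X ω ∈ G ∧ ∃ k, n * lam / 2 ≤ |((X ω)ᵀ *ᵥ W ω) k|} with hE₂
  set E₃ : Set Ω := {ω | ε ≤ |s ω / σ - 1|} with hE₃
  set h := ε * |t| + η with hh
  have hsand : ∀ ω, X ω ∈ G → ω ∉ E₂ → ω ∉ E₃ →
      (Z ω ≤ t - h → ω ∈ T) ∧ (ω ∈ T → Z ω ≤ t + h) := by
    intro ω hXG h2 h3
    rw [hE₂, Set.mem_ofPred_eq, not_and] at h2
    have h2' := h2 hXG
    push Not at h2'
    rw [hE₃, Set.mem_ofPred_eq, not_le] at h3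
    have hl1 := (hθ ω).sum_abs_sub_le hn hlam hC hθ₀ (fun k => (h2' k).le)
      (mul_sum_sq_le_quadratic_form hD.posSemidef hD.le_eigenvalues) hτ.le
      (fun k l => (hXG k l).1) hs₀
    exact studentized_le_sandwich (t := t) (w := W ω) hn hσ (hfeas _ hXG) (hτ.le.trans hτμ) hμ
      (hdiag _ hXG) hl1 hε h3 hη
  have hPG : P.real {ω | X ω ∈ G} = 1 - P.real E₁ := by
    have h1 : E₁ = {ω | X ω ∈ G}ᶜ := rfl
    have h2 : MeasurableSet {ω | X ω ∈ G} := hD.measurable hG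
    rw [h1, probReal_compl_eq_one_sub h2]; ring
  have hPG1 : P.real {ω | X ω ∈ G} ≤ 1 := measureReal_le_one
  have hupper : P.real T ≤ Φ (t + h) + (r₁ + r₂ + r₃) := by
    have hsub : T ⊆ (({ω | X ω ∈ G ∧ Z ω ≤ t + h} ∪ E₁) ∪ E₂) ∪ E₃ := by
      intro ω hω
      by_cases h3 : ω ∈ E₃
      · exact Or.inr h3
      by_cases h2 : ω ∈ E₂
      · exact Or.inl (Or.inr h2)
      by_cases h1 : X ω ∈ G
      · exact Or.inl (Or.inl (Or.inl ⟨h1, (hsand ω h1 h2 h3).2 hω⟩))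
      · exact Or.inl (Or.inl (Or.inr h1))
    have h1 := measureReal_mono (μ := P) hsub
    have h2 := measureReal_union_le (μ := P) (({ω | X ω ∈ G ∧ Z ω ≤ t + h} ∪ E₁) ∪ E₂) E₃
    have h3 := measureReal_union_le (μ := P) ({ω | X ω ∈ G ∧ Z ω ≤ t + h} ∪ E₁) E₂
    have h4 := measureReal_union_le (μ := P) {ω | X ω ∈ G ∧ Z ω ≤ t + h} E₁
    rw [hZcdf] at h4
    have h5 : Φ (t + h) * P.real {ω | X ω ∈ G} ≤ Φ (t + h) :=
      mul_le_of_le_one_right (cdf_nonneg _ _) hPG1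
    linarith
  -- Here the restriction to G loses Φ(t − h)·P(E₁) ≤ r₁.
  have hlower : Φ (t - h) ≤ P.real T + (r₁ + r₂ + r₃) := by
    have hsub : {ω | X ω ∈ G ∧ Z ω ≤ t - h} ⊆ (T ∪ E₂) ∪ E₃ := by
      rintro ω ⟨h1, hz⟩
      by_cases h3 : ω ∈ E₃
      · exact Or.inr h3
      by_cases h2 : ω ∈ E₂
      · exact Or.inl (Or.inr h2)
      exact Or.inl (Or.inl ((hsand ω h1 h2 h3).1 hz))
    have h1 := measureReal_mono (μ := P) hsub
    have h2 := measureReal_union_le (μ := P) (T ∪ E₂) E₃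
    have h3 := measureReal_union_le (μ := P) T E₂
    rw [hZcdf, hPG] at h1
    have h4 : Φ (t - h) * P.real E₁ ≤ P.real E₁ :=
      mul_le_of_le_one_left measureReal_nonneg (cdf_le_one _ _)
    linarith
  have hh0 : 0 ≤ h := by
    have h1 : 0 ≤ η := by
      refine le_trans ?_ hη
      have : 0 ≤ μ := hτ.le.trans hτμ
      positivity
    positivity
  have hm1 : Φ (t - h) ≤ Φ t := monotone_cdf _ (by linarith)
  have hm2 : Φ t ≤ Φ (t + h) := monotone_cdf _ (by linarith)
  rw [abs_le]
  constructor <;> linarith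

lemma exists_cdf_gaussianReal_sub_lt (x : ℝ) {δ : ℝ} (hδ : 0 < δ) :
    ∃ r > 0, ∀ h, 0 ≤ h → h ≤ r →
      cdf (gaussianReal 0 1) (x + h) - cdf (gaussianReal 0 1) (x - h) < δ := by
  obtain ⟨r, hr, h⟩ := Metric.continuousAt_iff.1 (continuous_cdf_gaussianReal.continuousAt (x := x))
    (δ / 2) (half_pos hδ)
  refine ⟨r / 2, half_pos hr, fun y hy0 hy => ?_⟩
  have h1 := h (x := x + y) (by rw [Real.dist_eq, add_sub_cancel_left, abs_of_nonneg hy0]; linarith)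
  have h2 := h (x := x - y) (by
    rw [Real.dist_eq, sub_sub_cancel_left, abs_neg, abs_of_nonneg hy0]; linarith)
  rw [Real.dist_eq] at h1 h2
  linarith [(abs_lt.1 h1).2, (abs_lt.1 h2).1]

end Inference

/-! ### Rates in n and p -/

section Asymptotics

lemma tendsto_mul_log_div_sqrt {p s₀ : ℕ → ℕ}
    (h : (fun n => (s₀ n : ℝ)) =o[atTop] (fun n => √(n : ℝ) / Real.log (p n))) :
    Tendsto (fun n => s₀ n * Real.log (p n) / √(n : ℝ)) atTop (𝓝 0) := by
  refine h.tendsto_div_nhds_zero.congr' ?_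
  filter_upwards with n
  rw [div_div_eq_mul_div]

/-- Lets every smallness requirement on q and s₀q follow from one on ρ = s₀ log p/√n, the quantity
that tends to 0. -/
lemma sqrt_log_div_le {n : ℕ} {s₀ L : ℝ} (hn : 0 < n) (hs : 1 ≤ s₀) (hL : 1 ≤ L) :
    √(L / n) ≤ s₀ * L / √(n : ℝ) ∧ s₀ * √(L / n) ≤ s₀ * L / √(n : ℝ) := by
  have hn' : (0 : ℝ) < √(n : ℝ) := Real.sqrt_pos.2 (by exact_mod_cast hn)
  have h1 : √(L / n) ≤ L / √(n : ℝ) := by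
    rw [Real.sqrt_div (by linarith)]
    gcongr
    exact Real.sqrt_le_iff.2 ⟨by linarith, by nlinarith⟩
  have h2 : s₀ * √(L / n) ≤ s₀ * L / √(n : ℝ) := by
    rw [mul_div_assoc]; gcongr
  exact ⟨(le_mul_of_one_le_left (Real.sqrt_nonneg _) hs).trans h2, h2⟩

lemma exp_neg_five_log_le {p : ℕ} (hp : 0 < p) :
    (p : ℝ) ^ 2 * (4 * Real.exp (-(5 * Real.log p))) ≤ 4 / p := by
  have hp' : (1 : ℝ) ≤ p := by exact_mod_cast hp
  have h : Real.exp (-(5 * Real.log p)) = ((p : ℝ) ^ 5)⁻¹ := by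
    rw [Real.exp_neg, show 5 * Real.log p = Real.log ((p : ℝ) ^ 5) by rw [Real.log_pow]; norm_num,
      Real.exp_log (by positivity)]
  rw [h]
  have : (p : ℝ) ^ 2 * (4 * ((p : ℝ) ^ 5)⁻¹) = 4 / (p : ℝ) ^ 3 := by field_simp
  rw [this]
  gcongr
  exact le_self_pow₀ hp' (by norm_num)

lemma exp_neg_four_log_le {p : ℕ} (hp : 0 < p) {y : ℝ} (hy : 4 * Real.log p ≤ y) :
    p * (2 * Real.exp (-y)) ≤ 2 / p := by
  have hp' : (1 : ℝ) ≤ p := by exact_mod_cast hp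
  have h : Real.exp (-y) ≤ ((p : ℝ) ^ 4)⁻¹ := by
    rw [← Real.exp_log (show (0 : ℝ) < (p : ℝ) ^ 4 by positivity), ← Real.exp_neg,
      Real.exp_le_exp, Real.log_pow]
    push_cast; linarith
  calc p * (2 * Real.exp (-y)) ≤ p * (2 * ((p : ℝ) ^ 4)⁻¹) := by gcongr
    _ = 2 / (p : ℝ) ^ 3 := by field_simp
    _ ≤ 2 / p := by
      gcongr
      exact le_self_pow₀ hp' (by norm_num)

end Asymptotics

end DebiasedLasso

/-! ### Choice of constants and passage to the limit -/

open DebiasedLasso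
theorem lemma13 :
    ∃ c₀ : ℝ, ∀ Cmin Cmax κ : ℝ, 0 < Cmin → 0 < Cmax → 0 < κ →
    ∃ a₀ : ℝ, ∀ a c : ℝ, a₀ ≤ a → c₀ ≤ c →
    -- the model: dimensions, sparsity levels, noise levels, random designs and noises
    ∀ (p s₀ : ℕ → ℕ) (σ : ℕ → ℝ)
      (Ω : ℕ → Type*) (_ : ∀ n, MeasurableSpace (Ω n))
      (P : ∀ n, Measure (Ω n)) (_ : ∀ n, IsProbabilityMeasure (P n))
      (S : ∀ n, Matrix (Fin (p n)) (Fin (p n)) ℝ)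
      (X : ∀ n, Ω n → Matrix (Fin n) (Fin (p n)) ℝ)
      (W : ∀ n, Ω n → Fin n → ℝ)
    -- the estimators, as functions of the data: LASSO, debiasing matrix, noise level
      (θhat : ∀ n, (Fin n → ℝ) → Matrix (Fin n) (Fin (p n)) ℝ → Fin (p n) → ℝ)
      (M : ∀ n, Matrix (Fin n) (Fin (p n)) ℝ → Matrix (Fin (p n)) (Fin (p n)) ℝ)
      (σhat : ∀ n, (Fin n → ℝ) → Matrix (Fin n) (Fin (p n)) ℝ → ℝ)
    -- the coordinate of interest
      (i : ∀ n, Fin (p n)),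
    Tendsto p atTop atTop →
    (∀ n, 1 ≤ s₀ n) →
    (fun n => (s₀ n : ℝ)) =o[atTop] (fun n => √(n : ℝ) / Real.log (p n)) →
    (∀ n, 0 < σ n) →
    (∀ n, IsSubGaussianDesign (P n) (X n) (S n) Cmin Cmax κ) →
    (∀ n, HasLaw (W n) (Measure.pi fun _ => gaussianReal 0 (σ n ^ 2).toNNReal) (P n)) →
    (∀ n, IndepFun (X n) (W n) (P n)) →
    (∀ n, Measurable (Function.uncurry (θhat n))) →
    (∀ n, Measurable (M n)) →
    (∀ n, Measurable (Function.uncurry (σhat n))) →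
    (∀ n y x, IsLassoEstimate (σ n * √(c ^ 2 * Real.log (p n) / n)) y x (θhat n y x)) →
    (∀ n x, IsDebiasingMatrix (a * √(Real.log (p n) / n)) (sampleCov x) (M n x)) →
    (∀ ε : ℝ, 0 < ε →
      Tendsto (fun n => ⨆ θ₀ : SparseVec (p n) (s₀ n),
        (P n).real {ω | ε ≤ |σhat n (X n ω *ᵥ θ₀.1 + W n ω) (X n ω) / σ n - 1|})
        atTop (𝓝 0)) →
    ∀ x : ℝ,
      Tendsto (fun n => ⨆ θ₀ : SparseVec (p n) (s₀ n),
        |(P n).real {ω |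
            studentized (σhat n (X n ω *ᵥ θ₀.1 + W n ω) (X n ω)) (X n ω) (M n (X n ω))
              (debiased (X n ω *ᵥ θ₀.1 + W n ω) (X n ω) (M n (X n ω))
                (θhat n (X n ω *ᵥ θ₀.1 + W n ω) (X n ω)))
              θ₀.1 (i n) ≤ x}
          - cdf (gaussianReal 0 1) x|)
        atTop (𝓝 0) := by
  -- With c ≥ 8 the noise exponent c² log p/16 is at least 4 log p, which beats the union bound over
  -- p coordinates.
  refine ⟨8, fun Cmin Cmax κ hCmin _ hκ => ?_⟩
  set s : ℝ := 1 / (4 * Real.exp 1 * (κ ^ 2 * (1 + 1 / Cmin))) with hs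
  have hs0 : 0 < s := by positivity
  have hsκ : 4 * Real.exp 1 * s * (κ ^ 2 * (1 + 1 / Cmin)) ≤ 1 := by
    rw [hs]; apply le_of_eq; field_simp
  -- The design tolerance below is τ = (30/s)q. Its Bernstein exponent is (900/176) log p ≥ 5 log p,
  -- beating the p² entries, and a ≥ 30/s ensures τ ≤ μ.
  refine ⟨30 / s, fun a c ha hc p s₀ σ Ω _ P _ S X W θhat M σhat i hp hs₀ hsparse hσ hD hW hXW
    _ hMm _ hθ hM hσhat x => ?_⟩
  have ha0 : 0 < a := lt_of_lt_of_le (by positivity) ha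
  have hc0 : 0 < c := by linarith
  rw [Metric.tendsto_nhds]
  intro δ hδ
  obtain ⟨r, hr, hcdf⟩ := exists_cdf_gaussianReal_sub_lt x (show 0 < δ / 4 by positivity)
  -- The threshold shift budget r is split equally between σ̂ (ε|x|) and the bias (η = r/2).
  set ε : ℝ := min 1 (r / 2 / (|x| + 1)) with hεdef
  have hε0 : 0 < ε := by positivity
  have hε1 : ε ≤ 1 := min_le_left _ _
  have hεx : ε * |x| ≤ r / 2 := by
    calc ε * |x| ≤ r / 2 / (|x| + 1) * (|x| + 1) := by
          gcongr
          · exact min_le_right _ _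
          · linarith
      _ = r / 2 := by field_simp
  have hρ := tendsto_mul_log_div_sqrt hsparse
  have hlog : Tendsto (fun n => Real.log (p n)) atTop atTop :=
    Real.tendsto_log_atTop.comp (tendsto_natCast_atTop_atTop.comp hp)
  have hpinv : Tendsto (fun n => 6 / (p n : ℝ)) atTop (𝓝 0) :=
    tendsto_const_nhds.div_atTop (tendsto_natCast_atTop_atTop.comp hp)
  -- The entries secure, in order: sτ ≤ 44, τ ≤ 1, μ ≤ 1/2, 32s₀τ ≤ Cmin (960 = 32·30), and bias at
  -- most r/2 (72 = 3·24).
  set r₀ : ℝ := min (min 1 (s / 30)) (min (min (1 / (2 * a)) (Cmin * s / 960))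
    (r / 2 / (72 * a * c / Cmin))) with hr₀
  have hr₀0 : 0 < r₀ := by positivity
  filter_upwards [eventually_gt_atTop 0, hlog.eventually_ge_atTop 1, hρ.eventually_le_const hr₀0,
    (hσhat ε hε0).eventually_lt_const (show 0 < δ / 4 by positivity),
    hpinv.eventually_lt_const (show 0 < δ / 4 by positivity), hp.eventually_gt_atTop 0]
    with n hn hL hρn hσn hpn hp0
  set L := Real.log (p n) with hLdef
  have hn' : (0 : ℝ) < n := by exact_mod_cast hn
  have hs₀' : (1 : ℝ) ≤ s₀ n := by exact_mod_cast hs₀ n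
  obtain ⟨hq1, hq2⟩ := sqrt_log_div_le hn hs₀' hL
  set q := √(L / n) with hq
  have hq0 : 0 < q := Real.sqrt_pos.2 (by positivity)
  have hqsq : q ^ 2 = L / n := Real.sq_sqrt (by positivity)
  set ρ := s₀ n * L / √(n : ℝ) with hρdef
  have hb1 : ρ ≤ 1 := hρn.trans ((min_le_left _ _).trans (min_le_left _ _))
  have hb2 : ρ ≤ s / 30 := hρn.trans ((min_le_left _ _).trans (min_le_right _ _))
  have hb3 : ρ ≤ 1 / (2 * a) := hρn.trans
    ((min_le_right _ _).trans ((min_le_left _ _).trans (min_le_left _ _)))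
  have hb4 : ρ ≤ Cmin * s / 960 := hρn.trans
    ((min_le_right _ _).trans ((min_le_left _ _).trans (min_le_right _ _)))
  have hb5 : ρ ≤ r / 2 / (72 * a * c / Cmin) := hρn.trans
    ((min_le_right _ _).trans (min_le_right _ _))
  have hlam : σ n * √(c ^ 2 * L / n) = σ n * (c * q) := by
    rw [mul_div_assoc, Real.sqrt_mul (sq_nonneg c), Real.sqrt_sq hc0.le]
  set τ := 30 / s * q with hτ
  have hτ0 : 0 < τ := by positivity
  have hsτ : s * τ = 30 * q := by rw [hτ]; field_simp
  have hτ1 : τ ≤ 1 := by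
    have : s * τ ≤ s * 1 := by rw [hsτ]; linarith
    exact le_of_mul_le_mul_left this hs0
  have hμ : a * q ≤ 1 / 2 := by
    calc a * q ≤ a * (1 / (2 * a)) := by gcongr; linarith
      _ = 1 / 2 := by field_simp
  have hs₀τ : 32 * s₀ n * τ ≤ Cmin := by
    have h1 : s * (32 * s₀ n * τ) ≤ s * Cmin := by
      calc s * (32 * s₀ n * τ) = 32 * s₀ n * (s * τ) := by ring
        _ = 960 * (s₀ n * q) := by rw [hsτ]; ring
        _ ≤ s * Cmin := by linarith
    exact le_of_mul_le_mul_left h1 hs0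
  have hη : 3 * (√(n : ℝ) * (a * q * (24 * s₀ n * (σ n * (c * q)) / Cmin))) / σ n ≤ r / 2 := by
    have hσn0 := hσ n
    have h1 : √(n : ℝ) * q ^ 2 = L / √(n : ℝ) := by
      rw [hqsq]
      have h2 : (0 : ℝ) < √(n : ℝ) := Real.sqrt_pos.2 hn'
      rw [mul_div_assoc', div_eq_div_iff hn'.ne' h2.ne']
      calc √(n : ℝ) * L * √(n : ℝ) = L * (√(n : ℝ) * √(n : ℝ)) := by ring
        _ = L * n := by rw [Real.mul_self_sqrt hn'.le]
    calc _ = 72 * a * c / Cmin * (s₀ n * (√(n : ℝ) * q ^ 2)) := by field_simp; ring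
      _ = 72 * a * c / Cmin * ρ := by rw [h1, hρdef, mul_div_assoc (s₀ n : ℝ)]
      _ ≤ 72 * a * c / Cmin * (r / 2 / (72 * a * c / Cmin)) := by gcongr
      _ = r / 2 := by field_simp
  have hr₁ : (P n).real {ω | ¬ IsGoodDesign τ (S n) (X n ω)} ≤ 4 / p n := by
    refine ((hD n).measure_not_isGoodDesign_le hCmin hκ.le hn hs0 hsκ hτ0
      (by rw [hsτ]; linarith)).trans ?_
    refine le_trans ?_ (exp_neg_five_log_le hp0)
    have h1 : 5 * L ≤ n * τ ^ 2 * s ^ 2 / 176 := by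
      have h2 : n * τ ^ 2 * s ^ 2 = n * (s * τ) ^ 2 := by ring
      have h3 : n * (s * τ) ^ 2 = 900 * L := by
        rw [hsτ, mul_pow, hqsq]; field_simp; norm_num
      rw [h2, h3]; linarith
    gcongr
  have hr₂ : (P n).real {ω | X n ω ∈ {x | IsGoodDesign τ (S n) x} ∧
      ∃ k, n * (σ n * (c * q)) / 2 ≤ |((X n ω)ᵀ *ᵥ W n ω) k|} ≤ 2 / p n := by
    have hσn0 := hσ n
    refine (measureReal_le_abs_transpose_mulVec_le (B := 2 * n) (hD n).measurable (hW n) (hXW n)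
      (measurableSet_isGoodDesign τ (S n)) (fun x hx k => ?_) (by positivity)).trans ?_
    · have h1 := (abs_le.1 (hx k k).1).2
      rw [sampleCov_apply] at h1
      have h2 : 1 / (n : ℝ) * ∑ j, x j k * x j k ≤ 2 := by linarith [(hD n).diag_le_one k]
      rw [one_div, inv_mul_le_iff₀ hn'] at h2
      simp only [sq]; linarith
    · rw [neg_div]
      apply exp_neg_four_log_le hp0
      have h1 : (n * (σ n * (c * q)) / 2) ^ 2 / (2 * (2 * n * σ n ^ 2)) = c ^ 2 * L / 16 := by
        have : (n * (σ n * (c * q)) / 2) ^ 2 = n ^ 2 * σ n ^ 2 * c ^ 2 * q ^ 2 / 4 := by ring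
        rw [this, hqsq]; field_simp; norm_num
      rw [h1]
      nlinarith [mul_le_mul hc hc (by norm_num) hc0.le]
  -- One δ/4 each for the increment of Φ, for σ̂, and for the exceptional events of total
  -- probability at most 6/p.
  have hbound : ∀ θ₀ : SparseVec (p n) (s₀ n), _ ≤ 3 * (δ / 4) := fun θ₀ => by
    have hr₃ : (P n).real {ω | ε ≤ |σhat n (X n ω *ᵥ θ₀.1 + W n ω) (X n ω) / σ n - 1|} ≤
        δ / 4 := by
      refine le_trans ?_ hσn.le
      exact le_ciSup (f := fun θ₀ : SparseVec (p n) (s₀ n) =>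
        (P n).real {ω | ε ≤ |σhat n (X n ω *ᵥ θ₀.1 + W n ω) (X n ω) / σ n - 1|})
        ⟨1, by rintro _ ⟨θ, rfl⟩; exact measureReal_le_one⟩ θ₀
    have h1 := abs_measureReal_studentized_sub_cdf_le (s₀ := s₀ n) (M := M n)
      (θ := fun ω => θhat n (X n ω *ᵥ θ₀.1 + W n ω) (X n ω)) (hD n) hCmin hn (hσ n) (hW n)
      (hXW n) (hMm n) (hM n) (fun ω => hlam ▸ hθ n _ (X n ω)) θ₀.2 hτ0
      (mul_le_mul_of_nonneg_right ha hq0.le) hμ (mul_pos (hσ n) (mul_pos hc0 hq0)) hs₀τ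
      hε0.le hε1 hη hr₁ hr₂ hr₃ (i n) x
    have h2 := hcdf (ε * |x| + r / 2) (by positivity) (by linarith)
    have h3 : 4 / (p n : ℝ) + 2 / p n = 6 / p n := by ring
    exact h1.trans (by linarith)
  have hnonempty : Nonempty (SparseVec (p n) (s₀ n)) := ⟨⟨0, by simp⟩⟩
  rw [Real.dist_eq, sub_zero, abs_of_nonneg (Real.iSup_nonneg fun _ => abs_nonneg _)]
  exact (ciSup_le hbound).trans_lt (by linarith)
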